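/- Let $d\ge 1$, let $G\subset\mathbb R^d$ be a bounded Lipschitz domain, let $G_0\subset G$ be a Lebesgue measurable subset of positive measure, and let $T>0$ and $\alpha\in(0,1)$. Let $(\Omega,\mathcal F,\mathbb P)$ be a probability space and let $\xi:\Omega\to\mathbb R$ be a real random variable whose distribution is absolutely continuous with respect to the Lebesgue measure on $\mathbb R$. For $y_0\in L^2(G)=L^2(G;\mathbb C)$ and $u\in L^\infty((0,T)\times G_0)=L^\infty((0,T)\times G_0;\mathbb C)$ consider the time-fractional Schrödinger system with random diffusivity $\xi=\xi(\omega)$, $$ \begin{cases} \partial^{\alpha}_{0,t} y-\mathrm i\,\xi\,\Delta y=\mathbf 1_{G_0}u & \text{in }(0,T)\times G,\\ y=0 & \text{on }(0,T)\times\partial G,\\ y(0,\cdot)=y_0 & \text{in } G, \end{cases} $$ where $\partial^\alpha_{0,t}$ is the Caputo derivative of order $\alpha$, understood as $\partial^\alpha_{0,t}f(t)=\frac{\mathrm d}{\mathrm dt}\,\frac1{\Gamma(1-\alpha)}\int_0^t (t-\tau)^{-\alpha}\,(f(\tau)-f(0))\,\mathrm d\tau$ (which is $\frac1{\Gamma(1-\alpha)}\int_0^t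 (t-\tau)^{-\alpha}f'(\tau)\,\mathrm d\tau$ when $f$ is absolutely continuous). A weak solution is a function $y\in C([0,T];L^2(G))$ with $y(0)=y_0$ and $y(t)\in H^1_0(G)$ for a.e. $t\in(0,T)$ such that, for every $v\in H^1_0(G)$, the scalar function $t\mapsto\langle y(t),v\rangle_{L^2(G)}$ has a Caputo derivative in $L^1(0,T)$ and, for a.e. $t\in(0,T)$, $$\partial^\alpha_{0,t}\langle y(t),v\rangle_{L^2(G)}=-\mathrm i\,\xi\,\langle\nabla y(t),\nabla v\rangle_{L^2(G)}+\langle\mathbf 1_{G_0}u(t,\cdot),v\rangle_{L^2(G)} .$$ For almost every $\omega$ let $y(\cdot,\cdot;\xi(\omega);y_0;u)$ denote the weak solution with diffusivity $\xi(\omega)$. The system is called exactly averaged controllable in $L^2(G)$ (at time $T$, with controls in $L^\infty((0,T)\times G_0)$) if there is a constant $C>0$ such that for all $y_0,y_1\in L^2(G)$ there exists a control $u\in L^\infty((0,T)\times G_0)$, independent of $\omega$, with $$\|u\|_{L^\infty((0,T)\times G_0)}\le C\big(\|y_0\|_{L^2(G)}+\|y_1\|_{L^2(G)}\big)\qquad\text{and}\qquad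 \mathbb E\big(y(T,\cdot;\xi;y_0;u)\big)=y_1 .$$ Then the system is not exactly averaged controllable in $L^2(G)$ with controls in $L^\infty((0,T)\times G_0)$. -/

import Mathlib

open MeasureTheory ProbabilityTheory Set
open scoped ENNReal NNReal ComplexConjugate

namespace FracSchrodinger

noncomputable section

/-- The Euclidean space `ℝ^d`. -/
abbrev E (d : ℕ) : Type := EuclideanSpace ℝ (Fin d)

/-- The complex Hilbert space `L²(G) = L²(G; ℂ)`. -/
abbrev L2 {d : ℕ} (G : Set (E d)) : Type := Lp ℂ 2 ((volume : Measure (E d)).restrict G)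

/-- A bounded Lipschitz domain: a nonempty, connected, bounded open set which, near each boundary
point, is the strict epigraph of a Lipschitz function in the direction of some unit vector `e`.
(Here `x - ⟪e, x⟫ e` is the orthogonal projection of `x` onto the hyperplane `e^⊥`, so that only the
values of `γ` on `e^⊥` matter.) -/
structure IsLipschitzDomain {d : ℕ} (G : Set (E d)) : Prop where
  isOpen : IsOpen G
  isConnected : IsConnected G
  isBounded : Bornology.IsBounded G
  lipschitz_boundary : ∀ p ∈ frontier G, ∃ e : E d, ‖e‖ = 1 ∧
    ∃ γ : E d → ℝ, (∃ K : ℝ≥0, LipschitzWith K γ) ∧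
      ∃ r : ℝ, 0 < r ∧ ∀ x ∈ Metric.ball p r,
        (x ∈ G ↔ γ (x - inner ℝ e x • e) < inner ℝ e x)

/-- The pairs `(φ, ∇φ)` in `L²(G) × L²(G)^d`, for `φ ∈ C_c^∞(G; ℂ)`. -/
def testGraph {d : ℕ} (G : Set (E d)) : Set (L2 G × (Fin d → L2 G)) :=
  {p | ∃ φ : E d → ℂ, ContDiff ℝ ((⊤ : ℕ∞) : WithTop ℕ∞) φ ∧ HasCompactSupport φ ∧ tsupport φ ⊆ G ∧
    (p.1 : E d → ℂ) =ᵐ[volume.restrict G] φ ∧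
    ∀ i : Fin d, (p.2 i : E d → ℂ) =ᵐ[volume.restrict G]
      fun x => fderiv ℝ φ x (EuclideanSpace.single i 1)}

/-- The Sobolev space `H¹₀(G)`, the closure of `C_c^∞(G)` in `H¹(G)`, together with the weak
gradient: `(w, g) ∈ H10 G` means that `w ∈ H¹₀(G)` and `∇w = g`. -/
def H10 {d : ℕ} (G : Set (E d)) : Set (L2 G × (Fin d → L2 G)) :=
  closure (testGraph G)

/-- The left Riemann–Liouville fractional integral
`(I^β_{0,t} g)(t) = Γ(β)⁻¹ ∫₀ᵗ (t-s)^{β-1} g(s) ds`. -/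
def fracIntegral (β : ℝ) (g : ℝ → ℂ) (t : ℝ) : ℂ :=
  (Real.Gamma β)⁻¹ • ∫ s in (0 : ℝ)..t, ((t - s) ^ (β - 1) : ℝ) • g s

/-- `f ∈ L¹(0,T)` is the Caputo derivative `∂^α_{0,t} g` of the continuous function `g` on `[0,T]`,
in the usual sense for functions that need not be absolutely continuous:
`f = d/dt I^{1-α}_{0,t} (g - g(0))`, that is, `I^{1-α}_{0,t} (g - g(0))` is absolutely continuous,
vanishes at `0` and has the derivative `f`. If `g ∈ W^{1,1}(0,T)` this says `f = I^{1-α}_{0,t} g'`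
almost everywhere. -/
def HasCaputoDeriv (α T : ℝ) (g f : ℝ → ℂ) : Prop :=
  ContinuousOn g (Icc 0 T) ∧ IntervalIntegrable f volume 0 T ∧
    ∀ t ∈ Icc (0 : ℝ) T,
      fracIntegral (1 - α) (fun s => g s - g 0) t = ∫ s in (0 : ℝ)..t, f s

/-- The control space `L^∞((0,T) × G₀)`. -/
abbrev Control {d : ℕ} (T : ℝ) (G₀ : Set (E d)) : Type :=
  Lp ℂ ∞ (((volume : Measure ℝ).restrict (Ioo 0 T)).prod ((volume : Measure (E d)).restrict G₀))

/-- `⟨1_{G₀} u(t,·), v⟩_{L²(G)}`, linear in `u` and antilinear in `v`. -/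
def controlPairing {d : ℕ} {G : Set (E d)} {T : ℝ} {G₀ : Set (E d)} (u : Control T G₀)
    (v : L2 G) (t : ℝ) : ℂ :=
  ∫ x in G₀, u (t, x) * conj (v x)

/-- `y ∈ C([0,T]; L²(G))` is a weak solution of the time-fractional Schrödinger system
`∂^α_{0,t} y - i ξ Δ y = 1_{G₀} u` in `(0,T) × G`, `y = 0` on `(0,T) × ∂G`, `y(0,·) = y₀`:
for a.e. `t` one has `y(t) ∈ H¹₀(G)`, with gradient `g(t)`, and for every test function
`v ∈ H¹₀(G)`, with gradient `h`,
`∂^α_{0,t} ⟨y(t), v⟩ = - i ξ ⟨∇y(t), ∇v⟩ + ⟨1_{G₀} u(t,·), v⟩`.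
Mathlib's `inner ℂ a b` is antilinear in `a` and linear in `b`. -/
def IsWeakSolution {d : ℕ} (α T : ℝ) (G G₀ : Set (E d)) (ξ : ℝ) (y₀ : L2 G) (u : Control T G₀)
    (y : ℝ → L2 G) : Prop :=
  ContinuousOn y (Icc 0 T) ∧ y 0 = y₀ ∧
    ∃ g : ℝ → Fin d → L2 G,
      (∀ᵐ t ∂(volume.restrict (Ioo 0 T)), (y t, g t) ∈ H10 G) ∧
      ∀ (v : L2 G) (h : Fin d → L2 G), (v, h) ∈ H10 G →
        HasCaputoDeriv α T (fun t => inner ℂ v (y t))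
          (fun t => -Complex.I * (ξ : ℂ) * (∑ i, inner ℂ (h i) (g t i)) + controlPairing u v t)

/-- `Y = 𝔼(y(T,·; ξ; y₀; u))`: almost surely `y(ω)` is the weak solution of the system with the
diffusivity `ξ(ω)`, and `Y` is the (Bochner) expectation in `L²(G)` of its value at time `T`. -/
def IsAveragedState {d : ℕ} {Ω : Type*} [MeasurableSpace Ω] (P : Measure Ω) (ξ : Ω → ℝ)
    (α T : ℝ) (G G₀ : Set (E d)) (y₀ : L2 G) (u : Control T G₀) (Y : L2 G) : Prop :=
  ∃ y : Ω → ℝ → L2 G,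
    (∀ᵐ ω ∂P, IsWeakSolution α T G G₀ (ξ ω) y₀ u (y ω)) ∧
    Integrable (fun ω => y ω T) P ∧ ∫ ω, y ω T ∂P = Y

/-- Exact averaged controllability in `L²(G)` at time `T`, with controls in `L^∞((0,T) × G₀)` and
some finite control cost `C`. -/
def ExactlyAveragedControllable {d : ℕ} {Ω : Type*} [MeasurableSpace Ω] (P : Measure Ω)
    (ξ : Ω → ℝ) (α T : ℝ) (G G₀ : Set (E d)) : Prop :=
  ∃ C : ℝ, 0 < C ∧ ∀ y₀ y₁ : L2 G, ∃ u : Control T G₀,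
    ‖u‖ ≤ C * (‖y₀‖ + ‖y₁‖) ∧ IsAveragedState P ξ α T G G₀ y₀ u y₁

end

end FracSchrodinger

namespace FracSchrodinger

open Filter Topology FourierTransform

/-! High-frequency targets cannot be reached at bounded cost. Take $y_0=0$ and let the target be a
normalised Dirichlet eigenfunction $v_n$ with eigenvalue $\lambda_n\to\infty$. Controllability would
supply controls $u_n$ with $\|u_n\|_\infty\le C$ and $\mathbb E\langle y_n(T),v_n\rangle=1$ for
every $n$.

For fixed $\omega$ the component $f=\langle y_n,v_n\rangle$ solves the scalar equation
$\partial^\alpha f=-i\kappa f+c$, $f(0)=0$, with $\kappa=\xi(\omega)\lambda_n$ and $|c|\le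
C|G|^{1/2}$. Its resolvent kernel is $x^{\alpha-1}E_{\alpha,\alpha}(-i\kappa x^\alpha)$, so
$|f(T)|\le C|G|^{1/2}\int_0^T|x^{\alpha-1}E_{\alpha,\alpha}(-i\kappa x^\alpha)|\,dx$
(`norm_le_of_hasCaputoDeriv`).

For $\alpha<1$ the function $E_{\alpha,\alpha}$ is bounded on the imaginary axis and tends to $0$
along it, as an integral over the line $\mathrm{Re}\,p=1$ shows (`mittagLeffler_eq_integral`,
`tendsto_mittagLeffler`). Hence the $L^1$ norm above is bounded in $\kappa$ and vanishes as
$|\kappa|\to\infty$ (`tendsto_resolventNorm`). This is the smoothing that the unitary case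
$\alpha=1$ does not have.

Since $\xi$ has a density, $\xi\ne0$ almost surely, so $|\kappa|\to\infty$ almost surely, and
dominated convergence over $\Omega$ makes the expectations tend to $0$, although they all equal $1$.
The eigenfunctions come from a Rellich theorem (`isCompactOperator_embed`) and the spectral theorem
for $JJ^*$, where $J:H^1_0\to L^2$ is the embedding (`exists_dirichlet_eigenfunction`). -/

/-! ### Laplace transform of powers and its inversion on the line Re p = 1. -/

lemma integrableOn_rpow_mul_exp_neg_mul {s b : ℝ} (hs : -1 < s) (hb : 0 < b) :
    IntegrableOn (fun t : ℝ => t ^ s * Real.exp (-(b * t))) (Ioi 0) := by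
  have := integrableOn_rpow_mul_exp_neg_mul_rpow (p := 1) (s := s) hs one_pos hb
  simpa using this

lemma norm_cexp_neg_mul_ofReal (r : ℂ) (t : ℝ) :
    ‖Complex.exp (-(r * t))‖ = Real.exp (-(r.re * t)) := by
  rw [Complex.norm_exp]; simp

/-- Laplace transform of a power, as an analytic function in the right half plane. -/
lemma differentiableOn_laplace_rpow {s : ℝ} (hs : 0 < s) :
    DifferentiableOn ℂ (fun r : ℂ => ∫ t in Ioi (0 : ℝ), ((t ^ s : ℝ) : ℂ) * Complex.exp (-(r * t)))
      {r | 0 < r.re} := by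
  intro r₀ hr₀
  have hr₀' : 0 < r₀.re := hr₀
  have hmeas : ∀ r : ℂ, ∀ a : ℝ, 0 < a → AEStronglyMeasurable
      (fun t : ℝ => ((t ^ a : ℝ) : ℂ) * Complex.exp (-(r * t))) (volume.restrict (Ioi 0)) := by
    intro r a ha
    refine (Continuous.mul ?_ (by fun_prop)).aestronglyMeasurable
    exact Complex.continuous_ofReal.comp (Real.continuous_rpow_const ha.le)
  have key := hasDerivAt_integral_of_dominated_loc_of_deriv_le
    (μ := volume.restrict (Ioi (0 : ℝ))) (𝕜 := ℂ) (x₀ := r₀)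
    (F := fun r t => ((t ^ s : ℝ) : ℂ) * Complex.exp (-(r * t)))
    (F' := fun r t => ((t ^ s : ℝ) : ℂ) * (Complex.exp (-(r * t)) * (-(t : ℂ))))
    (bound := fun t => t ^ (s + 1) * Real.exp (-(r₀.re / 2 * t)))
    (s := {r | r₀.re / 2 < r.re})
    ((isOpen_lt continuous_const Complex.continuous_re).mem_nhds (by
      simp only [mem_ofPred_eq]; linarith))
    (Eventually.of_forall fun r => hmeas r s hs) ?_ ?_ ?_
    (integrableOn_rpow_mul_exp_neg_mul (by linarith) (by linarith)) ?_
  · exact key.2.differentiableAt.differentiableWithinAt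
  · refine Integrable.mono' (integrableOn_rpow_mul_exp_neg_mul (s := s) (by linarith) hr₀') (hmeas r₀ s hs) ?_
    refine (ae_restrict_iff' measurableSet_Ioi).2 (ae_of_all _ fun t ht => ?_)
    rw [norm_mul, norm_cexp_neg_mul_ofReal, Complex.norm_real,
      Real.norm_of_nonneg (Real.rpow_nonneg (le_of_lt ht) _)]
  · refine (Continuous.mul ?_ (by fun_prop)).aestronglyMeasurable
    exact Complex.continuous_ofReal.comp (Real.continuous_rpow_const hs.le)
  · refine (ae_restrict_iff' measurableSet_Ioi).2 (ae_of_all _ fun t ht r hr => ?_)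
    have ht' : (0 : ℝ) < t := ht
    rw [norm_mul, norm_mul, norm_cexp_neg_mul_ofReal, Complex.norm_real, norm_neg, Complex.norm_real,
      Real.norm_of_nonneg (Real.rpow_nonneg ht'.le _), Real.norm_of_nonneg ht'.le,
      Real.rpow_add ht', Real.rpow_one]
    have : Real.exp (-(r.re * t)) ≤ Real.exp (-(r₀.re / 2 * t)) := by
      apply Real.exp_le_exp.2
      have : r₀.re / 2 < r.re := hr
      nlinarith
    have h0 := Real.rpow_nonneg ht'.le s
    calc t ^ s * (Real.exp (-(r.re * t)) * t) = (t ^ s * t) * Real.exp (-(r.re * t)) := by ring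
      _ ≤ _ := by gcongr
  · refine ae_of_all _ fun t r _ => ?_
    have : HasDerivAt (fun r : ℂ => Complex.exp (-(r * t))) (Complex.exp (-(r * t)) * (-(t : ℂ))) r := by
      have h1 : HasDerivAt (fun r : ℂ => -(r * t)) (-(t : ℂ)) r := by
        have h0 := ((hasDerivAt_id r).mul_const (t : ℂ)).fun_neg
        simpa using h0
      exact h1.cexp
    exact this.const_mul _

/-- For real $r$ this is Euler's integral; both sides are analytic in the right half plane, so the
identity theorem extends it to complex $r$. The points $1+1/(n+1)$ accumulate at $1$ without being
equal to it. -/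
lemma laplace_rpow {s : ℝ} (hs : 0 < s) {r : ℂ} (hr : 0 < r.re) :
    ∫ t in Ioi (0 : ℝ), ((t ^ s : ℝ) : ℂ) * Complex.exp (-(r * t))
      = r ^ (-(s + 1 : ℂ)) * Complex.Gamma (s + 1) := by
  have hU : IsOpen {r : ℂ | 0 < r.re} := isOpen_lt continuous_const Complex.continuous_re
  have hconv : Convex ℝ {r : ℂ | 0 < r.re} := convex_halfSpace_re_gt 0
  have h1 := (differentiableOn_laplace_rpow hs).analyticOnNhd hU
  have h2 : AnalyticOnNhd ℂ (fun r : ℂ => r ^ (-(s + 1 : ℂ)) * Complex.Gamma (s + 1))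
      {r : ℂ | 0 < r.re} := by
    refine DifferentiableOn.analyticOnNhd (fun z hz => ?_) hU
    have : z ∈ Complex.slitPlane := Or.inl hz
    exact ((differentiableAt_id.cpow_const this).mul_const _).differentiableWithinAt
  refine h1.eqOn_of_preconnected_of_frequently_eq h2 hconv.isPreconnected
    (z₀ := 1) (by simp) ?_ hr
  have ht : Tendsto (fun n : ℕ => (((1 : ℝ) + 1 / ((n : ℝ) + 1) : ℝ) : ℂ)) atTop (𝓝[≠] 1) := by
    refine tendsto_nhdsWithin_iff.2 ⟨?_, Eventually.of_forall fun n => ?_⟩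
    · have := (tendsto_const_nhds (x := (1 : ℝ))).add
        (tendsto_one_div_add_atTop_nhds_zero_nat (𝕜 := ℝ))
      have h3 := (Complex.continuous_ofReal.tendsto _).comp this
      simpa [Function.comp_def] using h3
    · have : (0 : ℝ) < 1 / ((n : ℝ) + 1) := by positivity
      simp only [mem_compl_iff, mem_singleton_iff]
      intro h
      have h' : (1 : ℝ) + 1 / ((n : ℝ) + 1) = 1 := by exact_mod_cast h
      linarith
  refine ht.frequently (Frequently.of_forall fun n => ?_)
  set a : ℝ := 1 + 1 / ((n : ℝ) + 1)
  have ha : 0 < a := by positivity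
  have := Complex.integral_cpow_mul_exp_neg_mul_Ioi (a := (s + 1 : ℂ)) (r := a) (by simp; linarith) ha
  rw [one_div, Complex.inv_cpow _ _ (by rw [Complex.arg_ofReal_of_nonneg ha.le]; exact Real.pi_pos.ne),
    ← Complex.cpow_neg] at this
  rw [← this]
  refine setIntegral_congr_fun measurableSet_Ioi fun t ht => ?_
  simp only [add_sub_cancel_right]
  rw [Complex.ofReal_cpow (le_of_lt ht)]

/-- The points `1 + 2πiw` of the line `Re p = 1`. -/
noncomputable def vline (w : ℝ) : ℂ := 1 + 2 * Real.pi * w * Complex.I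

@[simp] lemma vline_re (w : ℝ) : (vline w).re = 1 := by simp [vline]

lemma vline_im (w : ℝ) : (vline w).im = 2 * Real.pi * w := by simp [vline]

lemma vline_ne_zero (w : ℝ) : vline w ≠ 0 := fun h => by
  have := vline_re w; rw [h] at this; simp at this

lemma vline_mem_slitPlane (w : ℝ) : vline w ∈ Complex.slitPlane := Or.inl (by simp)

@[fun_prop] lemma continuous_vline : Continuous vline := by unfold vline; fun_prop

lemma one_le_norm_vline (w : ℝ) : 1 ≤ ‖vline w‖ := by
  simpa using Complex.abs_re_le_norm (vline w)

lemma one_add_norm_le_two_mul_norm_vline (w : ℝ) : 1 + ‖w‖ ≤ 2 * ‖vline w‖ := by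
  have h1 := one_le_norm_vline w
  have h2 := Complex.abs_im_le_norm (vline w)
  rw [vline_im, abs_mul, abs_of_pos (by positivity : 0 < 2 * Real.pi)] at h2
  have h3 := Real.pi_gt_three
  rw [Real.norm_eq_abs]
  nlinarith [abs_nonneg w]

/-- This is the dominating function for the integrals over the line. -/
lemma integrable_norm_vline_rpow {a : ℝ} (ha : 0 < a) :
    Integrable (fun w : ℝ => ‖vline w‖ ^ (-a - 1)) := by
  have h := (integrable_one_add_norm (E := ℝ) (μ := volume) (r := a + 1)
    (by simp; linarith)).const_mul ((2 : ℝ) ^ (a + 1))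
  refine h.mono' ?_ (ae_of_all _ fun w => ?_)
  · refine Continuous.aestronglyMeasurable ?_
    exact (continuous_vline.norm).rpow_const fun w => Or.inl (norm_ne_zero_iff.2 (vline_ne_zero w))
  · rw [Real.norm_of_nonneg (by positivity), show -a - 1 = -(a + 1) by ring,
      Real.rpow_neg (norm_nonneg _), Real.rpow_neg (by positivity), ← Real.inv_rpow (norm_nonneg _),
      ← Real.inv_rpow (by positivity), ← Real.mul_rpow (by positivity) (by positivity)]
    refine Real.rpow_le_rpow (by positivity) ?_ (by linarith)
    have := one_add_norm_le_two_mul_norm_vline w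
    have h1 := one_le_norm_vline w
    rw [← div_eq_mul_inv, inv_eq_one_div, div_le_div_iff₀ (by linarith) (by positivity)]
    linarith

lemma norm_vline_cpow (w a : ℝ) : ‖vline w ^ (a : ℂ)‖ = ‖vline w‖ ^ a :=
  Complex.norm_cpow_real _ _

/-- Fourier inversion at $t=1$ for $t_+^s e^{-t}$: its Fourier transform at $w$ is the Laplace
transform of $t^s$ at `vline w`. The condition $s>0$ makes $p^{-s-1}$ absolutely integrable on the
line. -/
lemma integral_exp_vline_mul_cpow {s : ℝ} (hs : 0 < s) :
    ∫ w : ℝ, Complex.exp (vline w) * vline w ^ (-(s + 1 : ℂ)) = ((Real.Gamma (s + 1))⁻¹ : ℝ) := by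
  set f : ℝ → ℂ := (Ioi (0 : ℝ)).indicator fun t => ((t ^ s * Real.exp (-t) : ℝ) : ℂ) with hf
  have hfc : ContinuousAt f 1 := by
    have h1 : ContinuousAt (fun t : ℝ => ((t ^ s * Real.exp (-t) : ℝ) : ℂ)) 1 := by
      have : Continuous fun t : ℝ => t ^ s := Real.continuous_rpow_const hs.le
      fun_prop
    refine h1.congr ?_
    filter_upwards [Ioi_mem_nhds (zero_lt_one (α := ℝ))] with t ht
    simp [hf, indicator_of_mem ht]
  have hfi : Integrable f := by
    rw [hf, integrable_indicator_iff measurableSet_Ioi]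
    have := (integrableOn_rpow_mul_exp_neg_mul (s := s) (b := 1) (by linarith) one_pos)
    simp only [one_mul] at this
    exact this.ofReal
  have hFT : 𝓕 f = fun w => vline w ^ (-(s + 1 : ℂ)) * Complex.Gamma (s + 1) := by
    ext w
    rw [← laplace_rpow hs (by simp : 0 < (vline w).re), Real.fourier_real_eq_integral_exp_smul,
      ← integral_indicator measurableSet_Ioi]
    congr 1
    ext t
    by_cases ht : t ∈ Ioi (0 : ℝ)
    · simp only [hf, indicator_of_mem ht, smul_eq_mul]
      push_cast
      rw [mul_left_comm, ← Complex.exp_add]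
      congr 2
      simp only [vline]
      ring
    · simp [hf, indicator_of_notMem ht]
  have hFi : Integrable (𝓕 f) := by
    rw [hFT]
    refine Integrable.mul_const ?_ _
    refine (integrable_norm_vline_rpow hs).mono' ?_ (ae_of_all _ fun w => ?_)
    · refine Continuous.aestronglyMeasurable ?_
      exact continuous_vline.cpow continuous_const fun w => vline_mem_slitPlane w
    · rw [show -(s + 1 : ℂ) = ((-s - 1 : ℝ) : ℂ) by push_cast; ring, norm_vline_cpow]
  have hinv := hfi.fourierInv_fourier_eq hFi hfc
  rw [Real.fourierInv_eq', hFT] at hinv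
  have hf1 : f 1 = Complex.exp (-1) := by simp [hf]
  rw [hf1] at hinv
  have hG : Complex.Gamma (s + 1) = (Real.Gamma (s + 1) : ℂ) := by
    rw [← Complex.Gamma_ofReal]; simp
  have hG0 : (Real.Gamma (s + 1) : ℂ) ≠ 0 := by
    exact_mod_cast (Real.Gamma_pos_of_pos (by linarith)).ne'
  have : (∫ w : ℝ, Complex.exp (vline w) * vline w ^ (-(s + 1 : ℂ))) * Real.Gamma (s + 1) = 1 := by
    rw [← integral_mul_const]
    have h2 := congrArg (fun z => Complex.exp 1 * z) hinv
    simp only [← Complex.exp_add] at h2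
    rw [← integral_const_mul] at h2
    simp only [add_neg_cancel, Complex.exp_zero] at h2
    refine Eq.trans ?_ h2
    congr 1
    ext w
    rw [hG, smul_eq_mul, ← mul_assoc, ← mul_assoc, ← Complex.exp_add]
    congr 3
    simp [vline]
  push_cast
  exact eq_inv_of_mul_eq_one_left this

/-! ### The Mittag-Leffler function: series, contour integral, decay on the imaginary axis. -/

/-- Keeping only $t>A$ in Euler's integral gives $\Gamma(x+1)\ge A^xe^{-A}$. As $A$ is free,
$1/\Gamma$ decays faster than any geometric rate. -/
lemma inv_Gamma_le {A x : ℝ} (hA : 0 < A) (hx : 0 < x) :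
    (Real.Gamma x)⁻¹ ≤ x * (Real.exp A * A ^ (-x)) := by
  have h1 : A ^ x * Real.exp (-A) ≤ Real.Gamma (x + 1) := by
    rw [Real.Gamma_eq_integral (by linarith)]
    have hi := Real.GammaIntegral_convergent (s := x + 1) (by linarith)
    have h2 : ∫ t in Ioi A, Real.exp (-t) * t ^ (x + 1 - 1)
        ≤ ∫ t in Ioi 0, Real.exp (-t) * t ^ (x + 1 - 1) := by
      refine setIntegral_mono_set hi ?_ (Ioi_subset_Ioi hA.le).eventuallyLE
      refine (ae_restrict_iff' measurableSet_Ioi).2 (ae_of_all _ fun t ht => ?_)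
      have : (0 : ℝ) < t := ht
      simp only [Pi.zero_apply]
      positivity
    refine le_trans ?_ h2
    have h3 : ∫ t in Ioi A, A ^ x * Real.exp (-t) = A ^ x * Real.exp (-A) := by
      rw [integral_const_mul, integral_exp_neg_Ioi]
    rw [← h3]
    refine setIntegral_mono_on ((integrableOn_exp_neg_Ioi A).const_mul _)
      (hi.mono_set (Ioi_subset_Ioi hA.le)) measurableSet_Ioi fun t ht => ?_
    have ht' : A < t := ht
    rw [add_sub_cancel_right, mul_comm]
    gcongr
  have hG := Real.Gamma_pos_of_pos hx
  rw [Real.Gamma_add_one hx.ne'] at h1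
  rw [Real.rpow_neg hA.le]
  have h3 : 0 < A ^ x := by positivity
  rw [Real.exp_neg, ← div_eq_mul_inv, div_le_iff₀ (Real.exp_pos A)] at h1
  rw [inv_eq_one_div, div_le_iff₀ hG]
  have h4 : x * (Real.exp A * (A ^ x)⁻¹) * Real.Gamma x
     = (x * Real.Gamma x * Real.exp A) / A ^ x := by field_simp
  rw [h4, le_div_iff₀ h3]
  linarith

/-- The coefficients `1 / Γ(α (n + 1))` of the Mittag-Leffler function `E_{α,α}`. -/
noncomputable def mlCoeff (α : ℝ) (n : ℕ) : ℝ := (Real.Gamma (α * (n + 1)))⁻¹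

lemma mlCoeff_pos {α : ℝ} (hα : 0 < α) (n : ℕ) : 0 < mlCoeff α n :=
  inv_pos.2 (Real.Gamma_pos_of_pos (by positivity))

lemma summable_mlCoeff_mul_pow {α : ℝ} (hα : 0 < α) {r : ℝ} (hr : 0 ≤ r) :
    Summable fun n => mlCoeff α n * r ^ n := by
  -- With this $A$ the terms are dominated by $(n+1)q^n$ up to a constant, with $q=r/A^\alpha<1$.
  obtain ⟨A, hA0, hAα⟩ : ∃ A : ℝ, 0 < A ∧ A ^ α = 2 * (r + 1) := by
    refine ⟨(2 * (r + 1)) ^ (1 / α), by positivity, ?_⟩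
    rw [← Real.rpow_mul (by positivity), one_div_mul_cancel hα.ne', Real.rpow_one]
  obtain ⟨q, hq⟩ : ∃ q : ℝ, q = r / (2 * (r + 1)) := ⟨_, rfl⟩
  have hq1 : ‖q‖ < 1 := by
    rw [hq, Real.norm_of_nonneg (by positivity), div_lt_one (by positivity)]; linarith
  have h1 : Summable fun n : ℕ => (α * Real.exp A * (2 * (r + 1))⁻¹) *
      ((n : ℝ) ^ 1 * q ^ n + q ^ n) :=
    ((summable_pow_mul_geometric_of_norm_lt_one 1 hq1).add
      (summable_geometric_of_norm_lt_one hq1)).mul_left _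
  refine Summable.of_nonneg_of_le (fun n => mul_nonneg (mlCoeff_pos hα n).le (pow_nonneg hr n))
    (fun n => ?_) h1
  have h2 := inv_Gamma_le hA0 (x := α * (n + 1)) (by positivity)
  have h3 : A ^ (-(α * ((n : ℝ) + 1))) = ((2 * (r + 1)) ^ n)⁻¹ * (2 * (r + 1))⁻¹ := by
    rw [Real.rpow_neg hA0.le, Real.rpow_mul hA0.le, hAα, Real.rpow_add (by positivity),
      Real.rpow_one, Real.rpow_natCast, mul_inv]
  rw [h3] at h2
  refine (mul_le_mul_of_nonneg_right h2 (pow_nonneg hr n)).trans_eq ?_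
  rw [hq, div_pow, pow_one, div_eq_mul_inv]
  ring

/-- The Mittag-Leffler function `E_{α,α}`. -/
noncomputable def mittagLeffler (α : ℝ) (z : ℂ) : ℂ := ∑' n, (mlCoeff α n : ℂ) * z ^ n

lemma norm_mlCoeff_mul_pow {α : ℝ} (hα : 0 < α) (z : ℂ) (n : ℕ) :
    ‖(mlCoeff α n : ℂ) * z ^ n‖ = mlCoeff α n * ‖z‖ ^ n := by
  rw [norm_mul, norm_pow, Complex.norm_real, Real.norm_of_nonneg (mlCoeff_pos hα n).le]

lemma differentiable_mittagLeffler {α : ℝ} (hα : 0 < α) : Differentiable ℂ (mittagLeffler α) := by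
  intro z
  have h := Complex.differentiableOn_tsum_of_summable_norm (U := Metric.ball (0 : ℂ) (‖z‖ + 1))
    (F := fun n z => (mlCoeff α n : ℂ) * z ^ n)
    (summable_mlCoeff_mul_pow hα (r := ‖z‖ + 1) (by positivity))
    (fun n => by fun_prop) Metric.isOpen_ball (fun n w hw => by
      rw [norm_mlCoeff_mul_pow hα]
      have := (mlCoeff_pos hα n).le
      have hw' : ‖w‖ ≤ ‖z‖ + 1 := (mem_ball_zero_iff.1 hw).le
      gcongr)
  exact h.differentiableAt (Metric.isOpen_ball.mem_nhds (by simp))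

/-- The integrand of the representation of `E_{α,α}` as an integral over the line `Re p = 1`. -/
noncomputable def mlKernel (α : ℝ) (z : ℂ) (w : ℝ) : ℂ :=
  Complex.exp (vline w) * (α * vline w ^ (α : ℂ) / (vline w * (vline w ^ (α : ℂ) - z) ^ 2))

@[fun_prop] lemma continuous_vline_cpow (α : ℂ) : Continuous fun w => vline w ^ α :=
  continuous_vline.cpow continuous_const fun w => vline_mem_slitPlane w

/-- On the line $|\arg p|\le\pi/2$, hence $|\arg p^\alpha|\le\alpha\pi/2<\pi/2$. This is where
$\alpha<1$ keeps $p^\alpha$ away from the imaginary axis. -/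
lemma cos_mul_norm_le_re_vline_cpow {α : ℝ} (hα : α ∈ Ioo (0 : ℝ) 1) (w : ℝ) :
    Real.cos (α * (Real.pi / 2)) * ‖vline w‖ ^ α ≤ (vline w ^ (α : ℂ)).re := by
  rw [Complex.cpow_ofReal_re, mul_comm]
  have harg : |(vline w).arg| ≤ Real.pi / 2 := Complex.abs_arg_le_pi_div_two_iff.2 (by simp)
  rw [← Real.cos_abs (_ * α), abs_mul, abs_of_pos hα.1]
  have hpi := Real.pi_pos
  have : Real.cos (α * (Real.pi / 2)) ≤ Real.cos (|(vline w).arg| * α) := by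
    refine Real.cos_le_cos_of_nonneg_of_le_pi (mul_nonneg (abs_nonneg _) hα.1.le) ?_ ?_
    · nlinarith [hα.2, hα.1]
    · nlinarith [hα.2, hα.1]
  gcongr

lemma cos_pos {α : ℝ} (hα : α ∈ Ioo (0 : ℝ) 1) : 0 < Real.cos (α * (Real.pi / 2)) := by
  have hpi := Real.pi_pos
  refine Real.cos_pos_of_mem_Ioo ⟨?_, ?_⟩ <;> nlinarith [hα.1, hα.2]

lemma one_le_norm_vline_rpow {α : ℝ} (hα : α ∈ Ioo (0 : ℝ) 1) (w : ℝ) : 1 ≤ ‖vline w‖ ^ α :=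
  Real.one_le_rpow (one_le_norm_vline w) hα.1.le

/-- Since $|p|\ge1$, a shift by $z$ with real part at most half of $\cos(\alpha\pi/2)$ uses up at
most half of $\mathrm{Re}\,p^\alpha$. The resulting half plane contains the imaginary axis and a
neighbourhood of $0$. -/
lemma norm_vline_cpow_sub_ge {α : ℝ} (hα : α ∈ Ioo (0 : ℝ) 1) (w : ℝ) {z : ℂ}
    (hz : z.re ≤ Real.cos (α * (Real.pi / 2)) / 2) :
    Real.cos (α * (Real.pi / 2)) / 2 * ‖vline w‖ ^ α ≤ ‖vline w ^ (α : ℂ) - z‖ := by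
  refine le_trans ?_ (Complex.re_le_norm _)
  have h1 := cos_mul_norm_le_re_vline_cpow hα w
  have h2 := one_le_norm_vline_rpow hα w
  have h3 := cos_pos hα
  rw [Complex.sub_re]
  nlinarith

lemma norm_exp_vline (w : ℝ) : ‖Complex.exp (vline w)‖ = Real.exp 1 := by
  rw [Complex.norm_exp, vline_re]

lemma norm_mlKernel (α : ℝ) (hα : 0 < α) (z : ℂ) (w : ℝ) :
    ‖mlKernel α z w‖ = Real.exp 1 * α * ‖vline w‖ ^ (α - 1) / ‖vline w ^ (α : ℂ) - z‖ ^ 2 := by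
  have := one_le_norm_vline w
  rw [mlKernel, norm_mul, norm_exp_vline, norm_div, norm_mul, norm_mul, norm_vline_cpow, norm_pow,
    Complex.norm_real, Real.norm_of_nonneg hα.le, Real.rpow_sub_one (by linarith)]
  field_simp

lemma norm_mlKernel_le {α : ℝ} (hα : α ∈ Ioo (0 : ℝ) 1) (w : ℝ) {z : ℂ}
    (hz : z.re ≤ Real.cos (α * (Real.pi / 2)) / 2) :
    ‖mlKernel α z w‖ ≤ Real.exp 1 * α / (Real.cos (α * (Real.pi / 2)) / 2) ^ 2 *
      ‖vline w‖ ^ (-α - 1) := by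
  have h1 := norm_vline_cpow_sub_ge hα w hz
  have h2 := cos_pos hα
  have h3 := one_le_norm_vline w
  have h4 := hα.1
  have h5 := one_le_norm_vline_rpow hα w
  rw [norm_mlKernel α hα.1]
  calc _ ≤ Real.exp 1 * α * ‖vline w‖ ^ (α - 1) /
        (Real.cos (α * (Real.pi / 2)) / 2 * ‖vline w‖ ^ α) ^ 2 := by gcongr
    _ = _ := by
      rw [mul_pow, ← Real.rpow_natCast (_ ^ α), ← Real.rpow_mul (by positivity),
        show -α - 1 = (α - 1) - α * (2 : ℕ) by push_cast; ring,
        Real.rpow_sub (by linarith) (α - 1)]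
      field_simp

lemma continuous_mlKernel {α : ℝ} (hα : α ∈ Ioo (0 : ℝ) 1) {z : ℂ}
    (hz : z.re ≤ Real.cos (α * (Real.pi / 2)) / 2) : Continuous (mlKernel α z) := by
  unfold mlKernel
  have : ∀ w, vline w ^ (α : ℂ) - z ≠ 0 := fun w h => by
    have h1 := norm_vline_cpow_sub_ge hα w hz
    rw [h, norm_zero] at h1
    have h2 := cos_pos hα
    have h5 := one_le_norm_vline_rpow hα w
    nlinarith
  refine Continuous.mul (by fun_prop) (Continuous.div (by fun_prop) (by fun_prop) fun w => ?_)
  exact mul_ne_zero (vline_ne_zero w) (pow_ne_zero _ (this w))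

lemma integrable_mlKernel {α : ℝ} (hα : α ∈ Ioo (0 : ℝ) 1) {z : ℂ}
    (hz : z.re ≤ Real.cos (α * (Real.pi / 2)) / 2) : Integrable (mlKernel α z) :=
  ((integrable_norm_vline_rpow hα.1).const_mul _).mono'
    (continuous_mlKernel hα hz).aestronglyMeasurable (ae_of_all _ fun w => norm_mlKernel_le hα w hz)

lemma differentiableOn_integral_mlKernel {α : ℝ} (hα : α ∈ Ioo (0 : ℝ) 1) :
    DifferentiableOn ℂ (fun z => ∫ w, mlKernel α z w)
      {z | z.re < Real.cos (α * (Real.pi / 2)) / 2} := by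
  intro z₀ hz₀
  have hne : ∀ (w : ℝ) (z : ℂ), z.re < Real.cos (α * (Real.pi / 2)) / 2 →
      vline w ^ (α : ℂ) - z ≠ 0 := fun w z hz h => by
    have h1 := norm_vline_cpow_sub_ge hα w hz.le
    rw [h, norm_zero] at h1
    have h2 := cos_pos hα
    have h5 := one_le_norm_vline_rpow hα w
    nlinarith
  have hopen : IsOpen {z : ℂ | z.re < Real.cos (α * (Real.pi / 2)) / 2} :=
    isOpen_lt Complex.continuous_re continuous_const
  have key := hasDerivAt_integral_of_dominated_loc_of_deriv_le
    (μ := (volume : Measure ℝ)) (𝕜 := ℂ) (x₀ := z₀)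
    (F := mlKernel α)
    (F' := fun z w => mlKernel α z w * (2 / (vline w ^ (α : ℂ) - z)))
    (bound := fun w => Real.exp 1 * α / (Real.cos (α * (Real.pi / 2)) / 2) ^ 2 *
      ‖vline w‖ ^ (-α - 1) * (2 / (Real.cos (α * (Real.pi / 2)) / 2)))
    (hopen.mem_nhds hz₀)
    (by filter_upwards [hopen.mem_nhds hz₀] with z hz
        exact (continuous_mlKernel hα (le_of_lt hz)).aestronglyMeasurable)
    (integrable_mlKernel hα (le_of_lt hz₀)) ?_ ?_
    (((integrable_norm_vline_rpow hα.1).const_mul _).mul_const _) ?_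
  · exact key.2.differentiableAt.differentiableWithinAt
  · exact ((continuous_mlKernel hα (le_of_lt hz₀)).mul
      (continuous_const.div (by fun_prop) fun w => hne w z₀ hz₀)).aestronglyMeasurable
  · refine ae_of_all _ fun w z hz => ?_
    have h1 := norm_vline_cpow_sub_ge hα w (le_of_lt hz)
    have h2 := cos_pos hα
    have h5 := one_le_norm_vline_rpow hα w
    rw [norm_mul, norm_div]
    have h6 : Real.cos (α * (Real.pi / 2)) / 2 ≤ ‖vline w ^ (α : ℂ) - z‖ := by nlinarith
    have h7 := norm_mlKernel_le hα w (le_of_lt hz)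
    rw [show ‖(2 : ℂ)‖ = 2 by simp]
    have h8 := (norm_nonneg _).trans h7
    gcongr
  · refine ae_of_all _ fun w z hz => ?_
    have h1 := hne w z hz
    have h2 := vline_ne_zero w
    have hd : HasDerivAt (fun z => vline w * (vline w ^ (α : ℂ) - z) ^ 2)
        (vline w * (2 * (vline w ^ (α : ℂ) - z) * (-1))) z := by
      have h3 : HasDerivAt (fun z => vline w ^ (α : ℂ) - z) (-1) z := by
        simpa using (hasDerivAt_id z).const_sub (vline w ^ (α : ℂ))
      have h4 := (h3.fun_pow 2).const_mul (vline w)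
      simpa using h4
    have h5 := ((hasDerivAt_const z (α * vline w ^ (α : ℂ))).fun_div hd
      (mul_ne_zero h2 (pow_ne_zero _ h1))).const_mul (Complex.exp (vline w))
    refine h5.congr_deriv ?_
    simp only [mlKernel]
    field_simp
    ring

/-- Writing $1/\Gamma(\alpha(n+1))=\alpha(n+1)/\Gamma(\alpha(n+1)+1)$ gains one power of $p$, which
makes each term absolutely integrable. The extra factor $n+1$ turns the geometric series in
$z/p^\alpha$ into its derivative, hence the squared denominator in `mlKernel`. -/
lemma hasSum_mlKernel {α : ℝ} (hα : 0 < α) {z : ℂ} (hz : ‖z‖ < 1) (w : ℝ) :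
    HasSum (fun n : ℕ => (α * (n + 1) * z ^ n) *
      (Complex.exp (vline w) * vline w ^ (-((α * (n + 1) : ℝ) + 1 : ℂ)))) (mlKernel α z w) := by
  set P : ℂ := vline w ^ (α : ℂ) with hP
  have hp := vline_ne_zero w
  have hPn : 1 ≤ ‖P‖ := by
    rw [hP, norm_vline_cpow]; exact Real.one_le_rpow (one_le_norm_vline w) hα.le
  have hP0 : P ≠ 0 := norm_pos_iff.1 (by linarith)
  have hr : ‖z / P‖ < 1 := by
    rw [norm_div, div_lt_one (by linarith)]; linarith
  have h1 := (hasSum_choose_mul_geometric_of_norm_lt_one 1 hr).mul_left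
    (Complex.exp (vline w) * (α / (vline w * P)))
  have h2 : P - z ≠ 0 := fun h => by
    rw [sub_eq_zero] at h
    rw [← h] at hz; linarith
  have h3 : (1 - z / P) ≠ 0 := by
    intro h; apply h2; field_simp at h; simpa using h
  have e1 : ∀ n : ℕ, (α * (n + 1) * z ^ n) *
      (Complex.exp (vline w) * vline w ^ (-((α * (n + 1) : ℝ) + 1 : ℂ))) =
      Complex.exp (vline w) * (α / (vline w * P)) * ((n + 1).choose 1 * (z / P) ^ n) := by
    intro n
    have h4 : vline w ^ (-((α * (n + 1) : ℝ) + 1 : ℂ)) = (P ^ (n + 1) * vline w)⁻¹ := by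
      rw [Complex.cpow_neg, Complex.cpow_add _ _ hp, Complex.cpow_one]
      congr 2
      rw [hP, ← Complex.cpow_mul_nat]
      push_cast; rfl
    rw [h4, Nat.choose_one_right, div_pow]
    push_cast
    field_simp
    ring
  have e2 : mlKernel α z w =
      Complex.exp (vline w) * (α / (vline w * P)) * (1 / (1 - z / P) ^ (1 + 1)) := by
    have h5 : (1 - z / P) = (P - z) / P := by field_simp
    rw [mlKernel, ← hP, h5, one_add_one_eq_two, div_pow]
    field_simp
  rw [e2, funext e1]
  exact h1

lemma mittagLeffler_eq_integral_of_norm_lt {α : ℝ} (hα : 0 < α) {z : ℂ} (hz : ‖z‖ < 1) :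
    mittagLeffler α z = ∫ w, mlKernel α z w := by
  have hsum : Summable fun n : ℕ => (α * (n + 1) * ‖z‖ ^ n) := by
    have hq : ‖‖z‖‖ < 1 := by simpa using hz
    refine (((summable_pow_mul_geometric_of_norm_lt_one 1 hq).add
      (summable_geometric_of_norm_lt_one hq)).mul_left α).congr fun n => ?_
    ring
  have hbd : ∀ (n : ℕ) (w : ℝ), ‖(α * (n + 1) * z ^ n : ℂ) *
      (Complex.exp (vline w) * vline w ^ (-((α * (n + 1) : ℝ) + 1 : ℂ)))‖
      ≤ (α * (n + 1) * ‖z‖ ^ n) * (Real.exp 1 * ‖vline w‖ ^ (-α - 1)) := by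
    intro n w
    rw [norm_mul, norm_mul _ (z ^ n), norm_mul (Complex.exp _), norm_exp_vline, norm_pow,
      show -((α * (n + 1) : ℝ) + 1 : ℂ) = ((-(α * (n + 1)) - 1 : ℝ) : ℂ) by push_cast; ring,
      norm_vline_cpow,
      show (α * (n + 1) : ℂ) = ((α * (n + 1) : ℝ) : ℂ) by push_cast; ring, Complex.norm_real,
      Real.norm_of_nonneg (by positivity)]
    have : ‖vline w‖ ^ (-(α * ((n : ℝ) + 1)) - 1) ≤ ‖vline w‖ ^ (-α - 1) := by
      apply Real.rpow_le_rpow_of_exponent_le (one_le_norm_vline w)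
      have : (0 : ℝ) ≤ α * n := by positivity
      linarith
    gcongr
  have key := hasSum_integral_of_dominated_convergence (μ := (volume : Measure ℝ))
    (F := fun (n : ℕ) w => (α * (n + 1) * z ^ n : ℂ) *
      (Complex.exp (vline w) * vline w ^ (-((α * (n + 1) : ℝ) + 1 : ℂ)))) (f := mlKernel α z)
    (fun n w => (α * (n + 1) * ‖z‖ ^ n) * (Real.exp 1 * ‖vline w‖ ^ (-α - 1)))
    (fun n => Continuous.aestronglyMeasurable (by fun_prop))
    (fun n => ae_of_all _ (hbd n)) (ae_of_all _ fun w => hsum.mul_right _) ?_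
    (ae_of_all _ fun w => hasSum_mlKernel hα hz w)
  · rw [← key.tsum_eq, mittagLeffler]
    refine tsum_congr fun n => ?_
    have hs : 0 < α * ((n : ℝ) + 1) := by positivity
    rw [integral_const_mul, integral_exp_vline_mul_cpow hs, Real.Gamma_add_one hs.ne', mlCoeff]
    have hG := (Real.Gamma_pos_of_pos hs).ne'
    have hG' : (Real.Gamma (α * ((n : ℝ) + 1)) : ℂ) ≠ 0 := by exact_mod_cast hG
    have hs' : ((α * ((n : ℝ) + 1) : ℝ) : ℂ) ≠ 0 := by exact_mod_cast hs.ne'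
    have hα' : (α : ℂ) ≠ 0 := by exact_mod_cast hα.ne'
    push_cast at hs' hG' ⊢
    field_simp
  · simp_rw [tsum_mul_right]
    exact ((integrable_norm_vline_rpow hα).const_mul _).const_mul _

/-- Termwise integration gives the formula near $0$; the identity theorem carries it through the
half plane to the whole imaginary axis. -/
lemma mittagLeffler_eq_integral {α : ℝ} (hα : α ∈ Ioo (0 : ℝ) 1) {z : ℂ}
    (hz : z.re < Real.cos (α * (Real.pi / 2)) / 2) :
    mittagLeffler α z = ∫ w, mlKernel α z w := by
  have hopen : IsOpen {z : ℂ | z.re < Real.cos (α * (Real.pi / 2)) / 2} :=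
    isOpen_lt Complex.continuous_re continuous_const
  refine ((differentiable_mittagLeffler hα.1).differentiableOn.analyticOnNhd
    hopen).eqOn_of_preconnected_of_eventuallyEq
    ((differentiableOn_integral_mlKernel hα).analyticOnNhd hopen)
    (convex_halfSpace_re_lt _).isPreconnected (z₀ := 0) ?_ ?_ hz
  · simpa using cos_pos hα
  · filter_upwards [Metric.ball_mem_nhds (0 : ℂ) one_pos] with z hz
    exact mittagLeffler_eq_integral_of_norm_lt hα.1 (by simpa using hz)

lemma exists_norm_mittagLeffler_le {α : ℝ} (hα : α ∈ Ioo (0 : ℝ) 1) :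
    ∃ B : ℝ, 0 ≤ B ∧ ∀ x : ℝ, ‖mittagLeffler α (x * Complex.I)‖ ≤ B := by
  refine ⟨∫ w, ‖Real.exp 1 * α / (Real.cos (α * (Real.pi / 2)) / 2) ^ 2 * ‖vline w‖ ^ (-α - 1)‖,
    integral_nonneg fun w => norm_nonneg _, fun x => ?_⟩
  have hz : ((x : ℂ) * Complex.I).re < Real.cos (α * (Real.pi / 2)) / 2 := by
    simpa using cos_pos hα
  rw [mittagLeffler_eq_integral hα hz]
  exact norm_integral_le_of_norm_le ((integrable_norm_vline_rpow hα.1).const_mul _).norm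
    (ae_of_all _ fun w => (norm_mlKernel_le hα w hz.le).trans (Real.le_norm_self _))

/-- For fixed $w$ the denominator $|p^\alpha-ix|^2$ tends to infinity, and the bound on the kernel
does not depend on $x$. The filter $|x|\to\infty$ covers both signs because the diffusivity may be
negative. -/
lemma tendsto_mittagLeffler {α : ℝ} (hα : α ∈ Ioo (0 : ℝ) 1) :
    Tendsto (fun x : ℝ => mittagLeffler α (x * Complex.I)) (comap (fun x => |x|) atTop) (𝓝 0) := by
  have hz : ∀ x : ℝ, ((x : ℂ) * Complex.I).re < Real.cos (α * (Real.pi / 2)) / 2 := fun x => by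
    simpa using cos_pos hα
  have h : Tendsto (fun x : ℝ => ∫ w, mlKernel α (x * Complex.I) w) (comap (fun x => |x|) atTop)
      (𝓝 (∫ _ : ℝ, (0 : ℂ))) := by
    refine tendsto_integral_filter_of_dominated_convergence _
      (Eventually.of_forall fun x => (continuous_mlKernel hα (hz x).le).aestronglyMeasurable)
      (Eventually.of_forall fun x => ae_of_all _ fun w => norm_mlKernel_le hα w (hz x).le)
      ((integrable_norm_vline_rpow hα.1).const_mul _) (ae_of_all _ fun w => ?_)
    rw [tendsto_zero_iff_norm_tendsto_zero]
    simp_rw [norm_mlKernel α hα.1]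
    refine Tendsto.div_atTop tendsto_const_nhds ?_
    refine (tendsto_pow_atTop two_ne_zero).comp ?_
    have h1 : Tendsto (fun x : ℝ => |x| - ‖vline w ^ (α : ℂ)‖) (comap (fun x => |x|) atTop) atTop :=
      tendsto_atTop_add_const_right _ _ tendsto_comap
    refine tendsto_atTop_mono (fun x => ?_) h1
    have := norm_sub_norm_le ((x : ℂ) * Complex.I) (vline w ^ (α : ℂ))
    rw [norm_sub_rev] at this
    simpa using this
  rw [integral_zero] at h
  exact h.congr fun x => (mittagLeffler_eq_integral hα (hz x)).symm

/-! ### Riemann–Liouville integrals as convolutions and their semigroup law. -/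

/-- The kernel `x₊^{b-1} / Γ(b)` of the Riemann–Liouville integral of order `b`. -/
noncomputable def fracKernel (b x : ℝ) : ℝ :=
  (Ioi (0 : ℝ)).indicator (fun x => (Real.Gamma b)⁻¹ * x ^ (b - 1)) x

lemma fracKernel_of_pos {b x : ℝ} (hx : 0 < x) :
    fracKernel b x = (Real.Gamma b)⁻¹ * x ^ (b - 1) := indicator_of_mem (mem_Ioi.2 hx) _

lemma fracKernel_of_nonpos {b x : ℝ} (hx : x ≤ 0) : fracKernel b x = 0 :=
  indicator_of_notMem (fun h => absurd h (not_lt.2 hx)) _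

lemma fracKernel_nonneg {b : ℝ} (hb : 0 < b) (x : ℝ) : 0 ≤ fracKernel b x := by
  rcases lt_or_ge 0 x with hx | hx
  · rw [fracKernel_of_pos hx]
    have := Real.Gamma_pos_of_pos hb
    positivity
  · rw [fracKernel_of_nonpos hx]

@[fun_prop] lemma measurable_fracKernel (b : ℝ) : Measurable (fracKernel b) := by
  unfold fracKernel
  exact Measurable.indicator (by fun_prop) measurableSet_Ioi

lemma integrableOn_fracKernel {b : ℝ} (hb : 0 < b) (T : ℝ) :
    IntegrableOn (fracKernel b) (Iic T) := by
  have h1 : IntegrableOn (fun x : ℝ => (Real.Gamma b)⁻¹ * x ^ (b - 1)) (Ioc 0 T) := by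
    rcases le_or_gt T 0 with h | h
    · simp [Ioc_eq_empty (not_lt.2 h)]
    · rw [← intervalIntegrable_iff_integrableOn_Ioc_of_le h.le]
      exact (intervalIntegral.intervalIntegrable_rpow' (by linarith)).const_mul _
  unfold fracKernel
  rw [IntegrableOn, integrable_indicator_iff measurableSet_Ioi, IntegrableOn,
    Measure.restrict_restrict measurableSet_Ioi, Ioi_inter_Iic]
  exact h1

lemma integral_rpow_mul_sub_rpow {a b x : ℝ} (ha : 0 < a) (hb : 0 < b) (hx : 0 < x) :
    IntegrableOn (fun s => s ^ (b - 1) * (x - s) ^ (a - 1)) (Ioc 0 x) ∧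
    ∫ s in Ioc 0 x, s ^ (b - 1) * (x - s) ^ (a - 1)
      = x ^ (a + b - 1) * (Real.Gamma a * Real.Gamma b / Real.Gamma (a + b)) := by
  have hcongr : ∀ s ∈ Ioc 0 x, (s : ℂ) ^ ((b : ℂ) - 1) * ((x : ℂ) - s) ^ ((a : ℂ) - 1)
      = ((s ^ (b - 1) * (x - s) ^ (a - 1) : ℝ) : ℂ) := by
    intro s hs
    push_cast
    rw [Complex.ofReal_cpow hs.1.le, Complex.ofReal_cpow (sub_nonneg.2 hs.2)]
    push_cast; rfl
  have h2 := Complex.betaIntegral_scaled (b : ℂ) (a : ℂ) hx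
  rw [Complex.betaIntegral_eq_Gamma_mul_div _ _ (by simpa) (by simpa),
    intervalIntegral.integral_of_le hx.le, setIntegral_congr_fun measurableSet_Ioc hcongr,
    integral_complex_ofReal] at h2
  have h3 : ∫ s in Ioc 0 x, s ^ (b - 1) * (x - s) ^ (a - 1)
      = x ^ (a + b - 1) * (Real.Gamma a * Real.Gamma b / Real.Gamma (a + b)) := by
    have h4 : ((x : ℂ) ^ ((b : ℂ) + a - 1) * (Complex.Gamma b * Complex.Gamma a /
        Complex.Gamma (b + a))) = ((x ^ (a + b - 1) *
          (Real.Gamma a * Real.Gamma b / Real.Gamma (a + b)) : ℝ) : ℂ) := by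
      push_cast
      rw [Complex.ofReal_cpow hx.le, ← Complex.Gamma_ofReal, ← Complex.Gamma_ofReal,
        ← Complex.Gamma_ofReal]
      push_cast
      rw [add_comm (b : ℂ) a, mul_comm (Complex.Gamma b)]
    rw [h4] at h2
    exact_mod_cast h2
  refine ⟨?_, h3⟩
  -- Integrability is read off from the value: the integral of a non-integrable function is $0$ by
  -- convention, but the Beta value is positive.
  by_contra hni
  have h5 := integral_undef hni
  rw [h5] at h3
  have h6 := Real.Gamma_pos_of_pos ha
  have h7 := Real.Gamma_pos_of_pos hb
  have h8 := Real.Gamma_pos_of_pos (add_pos ha hb)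
  have : 0 < x ^ (a + b - 1) * (Real.Gamma a * Real.Gamma b / Real.Gamma (a + b)) := by positivity
  exact this.ne h3

lemma fracKernel_conv {a b : ℝ} (ha : 0 < a) (hb : 0 < b) (x : ℝ) :
    Integrable (fun s => fracKernel a (x - s) * fracKernel b s) ∧
    ∫ s, fracKernel a (x - s) * fracKernel b s = fracKernel (a + b) x := by
  have hzero : ∀ s, s ∉ Ioo 0 x → fracKernel a (x - s) * fracKernel b s = 0 := by
    intro s hs
    rcases le_or_gt s 0 with h | h
    · rw [fracKernel_of_nonpos h, mul_zero]
    · rcases le_or_gt x s with h' | h'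
      · rw [fracKernel_of_nonpos (sub_nonpos.2 h'), zero_mul]
      · exact absurd ⟨h, h'⟩ hs
  rcases le_or_gt x 0 with hx | hx
  · have : (fun s => fracKernel a (x - s) * fracKernel b s) = fun _ => 0 := by
      ext s; exact hzero s (fun h => by linarith [h.1, h.2])
    rw [this, fracKernel_of_nonpos hx]
    exact ⟨integrable_zero _ _ _, integral_zero _ _⟩
  · obtain ⟨h1, h2⟩ := integral_rpow_mul_sub_rpow ha hb hx
    have heq : (fun s => fracKernel a (x - s) * fracKernel b s) = (Ioo 0 x).indicator
        (fun s => ((Real.Gamma a)⁻¹ * (Real.Gamma b)⁻¹) * (s ^ (b - 1) * (x - s) ^ (a - 1))) := by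
      ext s
      by_cases hs : s ∈ Ioo 0 x
      · rw [indicator_of_mem hs, fracKernel_of_pos hs.1, fracKernel_of_pos (sub_pos.2 hs.2)]
        ring
      · rw [indicator_of_notMem hs, hzero s hs]
    rw [heq]
    refine ⟨(integrable_indicator_iff measurableSet_Ioo).2
      ((h1.mono_set Ioo_subset_Ioc_self).const_mul _), ?_⟩
    rw [integral_indicator measurableSet_Ioo, integral_const_mul, ← integral_Ioc_eq_integral_Ioo,
      h2, fracKernel_of_pos hx]
    have h6 := (Real.Gamma_pos_of_pos ha).ne'
    have h7 := (Real.Gamma_pos_of_pos hb).ne'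
    field_simp

/-- Restriction of a function to `[0, T]`, extended by zero. -/
noncomputable def cutoff (T : ℝ) (h : ℝ → ℂ) : ℝ → ℂ := (Icc 0 T).indicator h

lemma cutoff_of_mem {T t : ℝ} (ht : t ∈ Icc 0 T) (h : ℝ → ℂ) : cutoff T h t = h t :=
  indicator_of_mem ht _

lemma cutoff_of_notMem {T t : ℝ} (ht : t ∉ Icc 0 T) (h : ℝ → ℂ) : cutoff T h t = 0 :=
  indicator_of_notMem ht _

lemma integrable_cutoff {T : ℝ} {h : ℝ → ℂ} (hh : ContinuousOn h (Icc 0 T)) :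
    Integrable (cutoff T h) :=
  (integrable_indicator_iff measurableSet_Icc).2 (hh.integrableOn_compact isCompact_Icc)

lemma exists_norm_cutoff_le {T : ℝ} {h : ℝ → ℂ} (hh : ContinuousOn h (Icc 0 T)) :
    ∃ M, 0 ≤ M ∧ ∀ t, ‖cutoff T h t‖ ≤ M := by
  obtain ⟨M, hM⟩ := isCompact_Icc.exists_bound_of_continuousOn hh
  refine ⟨max M 0, le_max_right _ _, fun t => ?_⟩
  by_cases ht : t ∈ Icc 0 T
  · rw [cutoff_of_mem ht]; exact (hM t ht).trans (le_max_left _ _)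
  · rw [cutoff_of_notMem ht]; simp

/-- Writing the integral over the whole line leaves no variable limits to follow when Fubini is
applied. -/
lemma fracIntegral_eq {b T t : ℝ} (ht : t ∈ Icc 0 T) (h : ℝ → ℂ) :
    fracIntegral b h t = ∫ s, fracKernel b (t - s) • cutoff T h s := by
  have heq : (fun s => fracKernel b (t - s) • cutoff T h s) =ᵐ[volume] (Ioc 0 t).indicator
      (fun s => (Real.Gamma b)⁻¹ • (((t - s) ^ (b - 1) : ℝ) • h s)) := by
    have h0 : ∀ᵐ s : ℝ, s ≠ 0 := by simp [ae_iff]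
    have h1 : ∀ᵐ s : ℝ, s ≠ t := by simp [ae_iff]
    filter_upwards [h0, h1] with s hs0 hst
    by_cases hs : s ∈ Ioc 0 t
    · rw [indicator_of_mem hs, cutoff_of_mem ⟨hs.1.le, hs.2.trans ht.2⟩,
        fracKernel_of_pos (sub_pos.2 (lt_of_le_of_ne hs.2 hst)), mul_smul]
    · rw [indicator_of_notMem hs]
      rcases le_or_gt s 0 with h | h
      · rw [cutoff_of_notMem (fun h' => hs0 (le_antisymm h h'.1)), smul_zero]
      · rw [fracKernel_of_nonpos, zero_smul]
        by_contra h'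
        exact hs ⟨h, by linarith⟩
  rw [integral_congr_ae heq, integral_indicator measurableSet_Ioc, integral_smul, fracIntegral,
    intervalIntegral.integral_of_le ht.1]

lemma integrable_fracKernel_smul_cutoff {b : ℝ} (hb : 0 < b) {T : ℝ} {h : ℝ → ℂ}
    (hh : ContinuousOn h (Icc 0 T)) (t : ℝ) :
    Integrable fun s => fracKernel b (t - s) • cutoff T h s := by
  obtain ⟨M, hM0, hM⟩ := exists_norm_cutoff_le hh
  have h1 : Integrable ((Iic t).indicator (fracKernel b)) :=
    (integrable_indicator_iff measurableSet_Iic).2 (integrableOn_fracKernel hb t)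
  have h2 := (h1.comp_sub_left t).mul_const M
  refine h2.mono' ?_ (ae_of_all _ fun s => ?_)
  · exact (by fun_prop : Measurable fun s => fracKernel b (t - s)).aestronglyMeasurable.smul
      (integrable_cutoff hh).aestronglyMeasurable
  · rw [norm_smul, Real.norm_of_nonneg (fracKernel_nonneg hb _)]
    by_cases hs : t - s ∈ Iic t
    · rw [indicator_of_mem hs]
      exact mul_le_mul_of_nonneg_left (hM s) (fracKernel_nonneg hb _)
    · rw [indicator_of_notMem hs, cutoff_of_notMem (fun h => hs (by simpa using h.1))]
      simp

/-- Fubini reduces the law $I^aI^b=I^{a+b}$ to `fracKernel_conv`, that is, to the Beta integral;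
nonnegativity of the kernels turns the same identity into the absolute convergence needed. -/
lemma fracIntegral_fracIntegral {a b : ℝ} (ha : 0 < a) (hb : 0 < b) {T : ℝ} {h : ℝ → ℂ}
    (hh : ContinuousOn h (Icc 0 T)) {t : ℝ} (ht : t ∈ Icc 0 T) :
    fracIntegral a (fracIntegral b h) t = fracIntegral (a + b) h t := by
  have hconv : ∀ r, Integrable (fun s => fracKernel a (t - s) * fracKernel b (s - r)) ∧
      ∫ s, fracKernel a (t - s) * fracKernel b (s - r) = fracKernel (a + b) (t - r) := by
    intro r
    obtain ⟨h1, h2⟩ := fracKernel_conv ha hb (t - r)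
    have he : (fun s => fracKernel a (t - s) * fracKernel b (s - r)) =
        fun s => (fun s => fracKernel a (t - r - s) * fracKernel b s) (s - r) := by
      ext s; simp
    rw [he]
    refine ⟨h1.comp_sub_right r, ?_⟩
    rw [integral_sub_right_eq_self (fun s => fracKernel a (t - r - s) * fracKernel b s), h2]
  have hint : Integrable (Function.uncurry fun s r =>
      (fracKernel a (t - s) * fracKernel b (s - r)) • cutoff T h r) (volume.prod volume) := by
    have hmeas : AEStronglyMeasurable (Function.uncurry fun s r =>
        (fracKernel a (t - s) * fracKernel b (s - r)) • cutoff T h r)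
        ((volume : Measure ℝ).prod (volume : Measure ℝ)) := by
      have h1 : Measurable fun p : ℝ × ℝ => fracKernel a (t - p.1) * fracKernel b (p.1 - p.2) := by
        fun_prop
      exact h1.aestronglyMeasurable.smul (integrable_cutoff hh).aestronglyMeasurable.comp_snd
    rw [integrable_prod_iff' hmeas]
    refine ⟨ae_of_all _ fun r => (hconv r).1.smul_const (cutoff T h r), ?_⟩
    have : (fun r => ∫ s, ‖Function.uncurry (fun s r =>
        (fracKernel a (t - s) * fracKernel b (s - r)) • cutoff T h r) (s, r)‖) =
        fun r => ‖fracKernel (a + b) (t - r) • cutoff T h r‖ := by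
      ext r
      simp only [Function.uncurry_apply_pair, norm_smul]
      rw [integral_mul_const, ← (hconv r).2]
      congr 1
      rw [(hconv r).2, Real.norm_of_nonneg (fracKernel_nonneg (add_pos ha hb) _), ← (hconv r).2]
      refine integral_congr_ae (ae_of_all _ fun s => ?_)
      exact Real.norm_of_nonneg (mul_nonneg (fracKernel_nonneg ha _) (fracKernel_nonneg hb _))
    rw [this]
    exact (integrable_fracKernel_smul_cutoff (add_pos ha hb) hh t).norm
  -- Cutting off the inner integral only matters for $s>T$: for $s<0$ it vanishes by itself. For
  -- $s>T$ the outer kernel vanishes, since $t\le T$.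
  have hinner : ∀ s, cutoff T (fracIntegral b h) s =
      (Iic T).indicator (fun s => ∫ r, fracKernel b (s - r) • cutoff T h r) s := by
    intro s
    by_cases hs : s ∈ Icc 0 T
    · rw [cutoff_of_mem hs, fracIntegral_eq hs, indicator_of_mem (mem_Iic.2 hs.2)]
    · rw [cutoff_of_notMem hs]
      by_cases hs' : s ∈ Iic T
      · rw [indicator_of_mem hs']
        symm
        refine integral_eq_zero_of_ae (ae_of_all _ fun r => ?_)
        have hs0 : s < 0 := by
          by_contra h'
          exact hs ⟨not_lt.1 h', hs'⟩
        rcases lt_or_ge r 0 with hr | hr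
        · simp only [Pi.zero_apply]
          rw [cutoff_of_notMem (fun h' => absurd h'.1 (not_le.2 hr)), smul_zero]
        · simp only [Pi.zero_apply]
          rw [fracKernel_of_nonpos (by linarith), zero_smul]
      · rw [indicator_of_notMem hs']
  rw [fracIntegral_eq ht, fracIntegral_eq ht]
  calc ∫ s, fracKernel a (t - s) • cutoff T (fracIntegral b h) s
      = ∫ s, ∫ r, (fracKernel a (t - s) * fracKernel b (s - r)) • cutoff T h r := by
        refine integral_congr_ae (ae_of_all _ fun s => ?_)
        simp only [hinner, mul_smul]
        rw [integral_smul]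
        by_cases hs : s ∈ Iic T
        · rw [indicator_of_mem hs]
        · have : t - s ≤ 0 := by
            have : T < s := not_le.1 hs
            linarith [ht.2]
          rw [fracKernel_of_nonpos this, zero_smul, zero_smul]
    _ = ∫ r, ∫ s, (fracKernel a (t - s) * fracKernel b (s - r)) • cutoff T h r :=
        integral_integral_swap hint
    _ = _ := by
        refine integral_congr_ae (ae_of_all _ fun r => ?_)
        simp only
        rw [integral_smul_const, (hconv r).2]

lemma fracIntegral_one (h : ℝ → ℂ) (t : ℝ) : fracIntegral 1 h t = ∫ s in (0 : ℝ)..t, h s := by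
  simp [fracIntegral]

lemma fracIntegral_add_const_mul {b : ℝ} (hb : 0 < b) {T : ℝ} {g h : ℝ → ℂ} (z : ℂ)
    (hg : ContinuousOn g (Icc 0 T)) (hh : ContinuousOn h (Icc 0 T)) {t : ℝ} (ht : t ∈ Icc 0 T) :
    fracIntegral b (fun s => g s + z * h s) t = fracIntegral b g t + z * fracIntegral b h t := by
  rw [fracIntegral_eq ht, fracIntegral_eq ht, fracIntegral_eq ht, ← integral_const_mul,
    ← integral_add (integrable_fracKernel_smul_cutoff hb hg t)
      ((integrable_fracKernel_smul_cutoff hb hh t).const_mul z)]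
  refine integral_congr_ae (ae_of_all _ fun s => ?_)
  simp only
  by_cases hs : s ∈ Icc 0 T
  · rw [cutoff_of_mem hs, cutoff_of_mem hs, cutoff_of_mem hs, smul_add, mul_smul_comm]
  · rw [cutoff_of_notMem hs, cutoff_of_notMem hs, cutoff_of_notMem hs]; simp

lemma fracIntegral_congr {b T : ℝ} {g h : ℝ → ℂ} (hgh : EqOn g h (Icc 0 T)) {t : ℝ}
    (ht : t ∈ Icc 0 T) : fracIntegral b g t = fracIntegral b h t := by
  rw [fracIntegral_eq ht, fracIntegral_eq ht]
  congr 1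
  ext s
  by_cases hs : s ∈ Icc 0 T
  · rw [cutoff_of_mem hs, cutoff_of_mem hs, hgh hs]
  · rw [cutoff_of_notMem hs, cutoff_of_notMem hs]

/-- After $s=t-x$ the domain no longer depends on $t$; the maximum absorbs $x>t$ because $h(0)=0$.
Values at two times can then be subtracted under the integral. -/
lemma fracIntegral_eq_setIntegral {b T : ℝ} {h : ℝ → ℂ} (h0 : h 0 = 0) {t : ℝ}
    (ht : t ∈ Icc 0 T) :
    fracIntegral b h t =
      ∫ x in Ioc 0 T, ((Real.Gamma b)⁻¹ * x ^ (b - 1)) • h (max (t - x) 0) := by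
  rw [fracIntegral_eq ht, ← integral_sub_left_eq_self (fun s => _ • cutoff T h s) _ t,
    ← integral_indicator measurableSet_Ioc]
  refine integral_congr_ae (ae_of_all _ fun x => ?_)
  simp only [sub_sub_cancel]
  rcases le_or_gt x 0 with hx | hx
  · rw [fracKernel_of_nonpos hx, indicator_of_notMem (fun h => absurd h.1 (not_lt.2 hx)), zero_smul]
  rw [fracKernel_of_pos hx]
  rcases le_or_gt x t with hxt | hxt
  · rw [indicator_of_mem (mem_Ioc.2 ⟨hx, hxt.trans ht.2⟩), max_eq_left (sub_nonneg.2 hxt),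
      cutoff_of_mem (mem_Icc.2 ⟨sub_nonneg.2 hxt, by linarith [ht.2]⟩)]
  · rw [cutoff_of_notMem (fun h => by linarith [h.1]), smul_zero]
    by_cases hxT : x ∈ Ioc 0 T
    · rw [indicator_of_mem hxT, max_eq_right (by linarith), h0, smul_zero]
    · rw [indicator_of_notMem hxT]

lemma integrableOn_rpow_sub_one {b : ℝ} (hb : 0 < b) {T : ℝ} (hT : 0 ≤ T) :
    IntegrableOn (fun x : ℝ => x ^ (b - 1)) (Ioc 0 T) :=
  (intervalIntegrable_iff_integrableOn_Ioc_of_le hT).1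
    (intervalIntegral.intervalIntegrable_rpow' (by linarith))

lemma norm_fracIntegral_le {b T M : ℝ} (hb : 0 < b) {h : ℝ → ℂ} (h0 : h 0 = 0)
    (hM : ∀ t ∈ Icc 0 T, ‖h t‖ ≤ M) {t : ℝ} (ht : t ∈ Icc 0 T) :
    ‖fracIntegral b h t‖ ≤ (Real.Gamma b)⁻¹ * (T ^ b / b) * M := by
  have hT : 0 ≤ T := ht.1.trans ht.2
  have hG := Real.Gamma_pos_of_pos hb
  rw [fracIntegral_eq_setIntegral h0 ht]
  refine (norm_integral_le_of_norm_le
    (g := fun x => ((Real.Gamma b)⁻¹ * x ^ (b - 1)) * M)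
    (((integrableOn_rpow_sub_one hb hT).const_mul _).mul_const _)
    ((ae_restrict_iff' measurableSet_Ioc).2 (ae_of_all _ fun x hx => ?_))).trans_eq ?_
  · have hx0 := hx.1.le
    rw [norm_smul, Real.norm_of_nonneg (by positivity)]
    refine mul_le_mul_of_nonneg_left (hM _ ⟨le_max_right _ _, max_le ?_ hT⟩) (by positivity)
    linarith [ht.2]
  · rw [integral_mul_const, integral_const_mul, ← intervalIntegral.integral_of_le hT,
      integral_rpow (Or.inl (by linarith)), sub_add_cancel, Real.zero_rpow hb.ne', sub_zero]

/-! ### The Volterra equation and the scalar estimate at the final time. -/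

/-- The Neumann expansion of the Volterra equation `D = I^α (C + z D)`. -/
lemma volterra_iterate {α T : ℝ} (hα : 0 < α) {C D : ℝ → ℂ} {z : ℂ}
    (hC : ContinuousOn C (Icc 0 T)) (hD : ContinuousOn D (Icc 0 T))
    (hCD : ∀ t ∈ Icc 0 T, D t = fracIntegral α (fun s => C s + z * D s) t) (n : ℕ) :
    ∀ t ∈ Icc 0 T, D t = ∑ k ∈ Finset.range (n + 1), z ^ k * fracIntegral (α * (k + 1)) C t
      + z ^ (n + 1) * fracIntegral (α * (n + 1)) D t := by
  induction n with
  | zero =>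
    intro t ht
    rw [hCD t ht, fracIntegral_add_const_mul hα z hC hD ht]
    simp
  | succ n ih =>
    intro t ht
    have hn : 0 < α * ((n : ℝ) + 1) := by positivity
    have h1 : fracIntegral (α * (n + 1)) D t = fracIntegral (α * ((n + 1 : ℕ) + 1)) C t
        + z * fracIntegral (α * ((n + 1 : ℕ) + 1)) D t := by
      rw [fracIntegral_congr hCD ht,
        fracIntegral_fracIntegral (h := fun s => C s + z * D s) hn hα
          (hC.add (continuousOn_const.mul hD)) ht,
        fracIntegral_add_const_mul (by positivity) z hC hD ht]
      push_cast
      ring_nf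
    rw [ih t ht, h1, Finset.sum_range_succ _ (n + 1)]
    ring

/-- The kernels $x^{\alpha(k+1)-1}/\Gamma(\alpha(k+1))$ in the Neumann series add up to
$x^{\alpha-1}E_{\alpha,\alpha}(zx^\alpha)$. The remainder is bounded by a multiple of the general
term of the Mittag-Leffler series at $\|z\|T^\alpha$. -/
lemma volterra_representation {α T : ℝ} (hα : 0 < α) {C D : ℝ → ℂ} {z : ℂ}
    (hC : ContinuousOn C (Icc 0 T)) (hD : ContinuousOn D (Icc 0 T)) (hC0 : C 0 = 0) (hD0 : D 0 = 0)
    (hCD : ∀ t ∈ Icc 0 T, D t = fracIntegral α (fun s => C s + z * D s) t)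
    {t : ℝ} (ht : t ∈ Icc 0 T) :
    D t = ∫ x in Ioc 0 T, (((x ^ (α - 1) : ℝ) : ℂ) * mittagLeffler α (z * ((x ^ α : ℝ) : ℂ))) *
      C (max (t - x) 0) := by
  have hT : 0 ≤ T := ht.1.trans ht.2
  obtain ⟨MC, hMC⟩ := isCompact_Icc.exists_bound_of_continuousOn hC
  obtain ⟨MD, hMD⟩ := isCompact_Icc.exists_bound_of_continuousOn hD
  have hsum := summable_mlCoeff_mul_pow hα (r := ‖z‖ * T ^ α) (by positivity)
  have hmax : ∀ x ∈ Ioc 0 T, max (t - x) 0 ∈ Icc 0 T := fun x hx =>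
    ⟨le_max_right _ _, max_le (by linarith [ht.2, hx.1]) hT⟩
  -- the series converges to the integral
  have hpow : ∀ n : ℕ, ∀ x ∈ Ioc 0 T, (Real.Gamma (α * (n + 1)))⁻¹ * x ^ (α * ((n : ℝ) + 1) - 1)
      = mlCoeff α n * (x ^ α) ^ n * x ^ (α - 1) := by
    intro n x hx
    rw [mlCoeff, ← Real.rpow_natCast (x ^ α), ← Real.rpow_mul hx.1.le, mul_assoc,
      ← Real.rpow_add hx.1]
    ring_nf
  have hcont : ContinuousOn (fun x => C (max (t - x) 0)) (Ioc 0 T) :=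
    hC.comp (by fun_prop) hmax
  have hseries : HasSum (fun k : ℕ => z ^ k * fracIntegral (α * (k + 1)) C t)
      (∫ x in Ioc 0 T, (((x ^ (α - 1) : ℝ) : ℂ) * mittagLeffler α (z * ((x ^ α : ℝ) : ℂ))) *
        C (max (t - x) 0)) := by
    have hterm : ∀ k : ℕ, z ^ k * fracIntegral (α * (k + 1)) C t =
        ∫ x in Ioc 0 T, z ^ k * (((Real.Gamma (α * (k + 1)))⁻¹ * x ^ (α * ((k : ℝ) + 1) - 1)) •
          C (max (t - x) 0)) := by
      intro k
      rw [fracIntegral_eq_setIntegral hC0 ht, integral_const_mul]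
    simp_rw [hterm]
    refine hasSum_integral_of_dominated_convergence
      (fun n x => (mlCoeff α n * (‖z‖ * T ^ α) ^ n) * (x ^ (α - 1) * MC)) (fun n => ?_) (fun n => ?_)
      (ae_of_all _ fun x => hsum.mul_right _) ?_ ?_
    · have h1 : Measurable fun x : ℝ =>
          (Real.Gamma (α * (n + 1)))⁻¹ * x ^ (α * ((n : ℝ) + 1) - 1) := by fun_prop
      exact (h1.aestronglyMeasurable.smul
        (hcont.aestronglyMeasurable measurableSet_Ioc)).const_mul _
    · refine (ae_restrict_iff' measurableSet_Ioc).2 (ae_of_all _ fun x hx => ?_)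
      have hx0 := hx.1.le
      have hc := (mlCoeff_pos hα n).le
      rw [hpow n x hx, norm_mul, norm_pow, norm_smul, Real.norm_of_nonneg (by positivity), mul_pow]
      have h1 : (x ^ α) ^ n ≤ (T ^ α) ^ n := by
        gcongr
        exact hx.2
      calc ‖z‖ ^ n * (mlCoeff α n * (x ^ α) ^ n * x ^ (α - 1) * ‖C (max (t - x) 0)‖)
          ≤ ‖z‖ ^ n * (mlCoeff α n * (T ^ α) ^ n * x ^ (α - 1) * MC) := by
            gcongr
            exact hMC _ (hmax x hx)
        _ = _ := by ring
    · simp_rw [tsum_mul_right]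
      exact ((integrableOn_rpow_sub_one hα hT).mul_const _).const_mul _
    · refine (ae_restrict_iff' measurableSet_Ioc).2 (ae_of_all _ fun x hx => ?_)
      have hx0 := hx.1.le
      have hs : Summable fun n : ℕ => (mlCoeff α n : ℂ) * (z * ((x ^ α : ℝ) : ℂ)) ^ n := by
        refine Summable.of_norm ?_
        simp_rw [norm_mlCoeff_mul_pow hα]
        exact summable_mlCoeff_mul_pow hα (norm_nonneg _)
      have h1 := (hs.hasSum.mul_left ((x ^ (α - 1) : ℝ) : ℂ)).mul_right (C (max (t - x) 0))
      refine h1.congr_fun ?_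
      intro n
      rw [hpow n x hx, Complex.real_smul, mul_pow]
      push_cast
      ring
  -- the remainder tends to zero
  have hrem : Tendsto (fun n : ℕ => z ^ (n + 1) * fracIntegral (α * (n + 1)) D t) atTop (𝓝 0) := by
    have hlim : Tendsto (fun n : ℕ => mlCoeff α n * (‖z‖ * T ^ α) ^ n * (‖z‖ * T ^ α / α * MD))
        atTop (𝓝 0) := by
      simpa using hsum.tendsto_atTop_zero.mul_const (‖z‖ * T ^ α / α * MD)
    refine squeeze_zero_norm (fun n => ?_) hlim
    have hn : 0 < α * ((n : ℝ) + 1) := by positivity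
    have h1 := norm_fracIntegral_le hn hD0 hMD ht
    have hMD0 : 0 ≤ MD := (norm_nonneg _).trans (hMD t ht)
    have hc := (mlCoeff_pos hα n).le
    have h2 : T ^ (α * ((n : ℝ) + 1)) = (T ^ α) ^ n * T ^ α := by
      rw [Real.rpow_mul hT, ← pow_succ, ← Real.rpow_natCast (T ^ α) (n + 1)]
      push_cast; rfl
    have h3 : T ^ (α * ((n : ℝ) + 1)) / (α * (n + 1)) ≤ (T ^ α) ^ n * T ^ α / α := by
      rw [h2]
      refine div_le_div_of_nonneg_left (by positivity) hα ?_
      have : (0 : ℝ) ≤ n := by positivity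
      nlinarith
    rw [norm_mul, norm_pow]
    calc ‖z‖ ^ (n + 1) * ‖fracIntegral (α * (n + 1)) D t‖
        ≤ ‖z‖ ^ (n + 1) * (mlCoeff α n * ((T ^ α) ^ n * T ^ α / α) * MD) := by
          refine mul_le_mul_of_nonneg_left (h1.trans ?_) (by positivity)
          rw [mlCoeff]
          rw [mlCoeff] at hc
          gcongr
      _ = _ := by rw [mul_pow]; ring
  have h4 := ((tendsto_add_atTop_iff_nat 1).2 hseries.tendsto_sum_nat).add hrem
  rw [add_zero] at h4
  refine tendsto_nhds_unique (tendsto_const_nhds.congr fun n => ?_) h4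
  exact volterra_iterate hα hC hD hCD n t ht

/-- The `L¹(0,T)` norm of the resolvent kernel `x^{α-1} E_{α,α}(-iκ x^α)`. -/
noncomputable def resolventNorm (α T κ : ℝ) : ℝ :=
  ∫ x in Ioc 0 T, ‖((x ^ (α - 1) : ℝ) : ℂ) *
    mittagLeffler α (((-(κ * x ^ α) : ℝ) : ℂ) * Complex.I)‖

lemma measurable_resolvent {α : ℝ} (hα : 0 < α) (κ : ℝ) :
    Measurable fun x : ℝ => ((x ^ (α - 1) : ℝ) : ℂ) *
      mittagLeffler α (((-(κ * x ^ α) : ℝ) : ℂ) * Complex.I) := by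
  have h1 : Measurable fun x : ℝ => ((x ^ (α - 1) : ℝ) : ℂ) := by fun_prop
  have h2 : Measurable fun x : ℝ => (((-(κ * x ^ α) : ℝ) : ℂ) * Complex.I) := by fun_prop
  exact h1.mul ((differentiable_mittagLeffler hα).continuous.measurable.comp h2)

lemma norm_resolvent_le {α B : ℝ} (hB : ∀ x : ℝ, ‖mittagLeffler α (x * Complex.I)‖ ≤ B)
    (κ : ℝ) {x : ℝ} (hx : 0 ≤ x) :
    ‖((x ^ (α - 1) : ℝ) : ℂ) * mittagLeffler α (((-(κ * x ^ α) : ℝ) : ℂ) * Complex.I)‖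
      ≤ x ^ (α - 1) * B := by
  rw [norm_mul, Complex.norm_real, Real.norm_of_nonneg (Real.rpow_nonneg hx _)]
  exact mul_le_mul_of_nonneg_left (hB _) (Real.rpow_nonneg hx _)

lemma integrableOn_resolvent {α T : ℝ} (hα : α ∈ Ioo (0 : ℝ) 1) (hT : 0 ≤ T) (κ : ℝ) :
    IntegrableOn (fun x : ℝ => ((x ^ (α - 1) : ℝ) : ℂ) *
      mittagLeffler α (((-(κ * x ^ α) : ℝ) : ℂ) * Complex.I)) (Ioc 0 T) := by
  obtain ⟨B, -, hB⟩ := exists_norm_mittagLeffler_le hα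
  exact ((integrableOn_rpow_sub_one hα.1 hT).mul_const B).mono'
    (measurable_resolvent hα.1 κ).aestronglyMeasurable
    ((ae_restrict_iff' measurableSet_Ioc).2 (ae_of_all _ fun x hx => norm_resolvent_le hB κ hx.1.le))

lemma exists_resolventNorm_le {α T : ℝ} (hα : α ∈ Ioo (0 : ℝ) 1) (hT : 0 ≤ T) :
    ∃ B, ∀ κ, resolventNorm α T κ ≤ B := by
  obtain ⟨B, -, hB⟩ := exists_norm_mittagLeffler_le hα
  exact ⟨_, fun κ => setIntegral_mono_on (integrableOn_resolvent hα hT κ).norm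
    ((integrableOn_rpow_sub_one hα.1 hT).mul_const B) measurableSet_Ioc
    fun x hx => norm_resolvent_le hB κ hx.1.le⟩

lemma tendsto_resolventNorm {α T : ℝ} (hα : α ∈ Ioo (0 : ℝ) 1) (hT : 0 ≤ T) :
    Tendsto (resolventNorm α T) (comap (fun x => |x|) atTop) (𝓝 0) := by
  obtain ⟨B, -, hB⟩ := exists_norm_mittagLeffler_le hα
  have h : Tendsto (resolventNorm α T) (comap (fun x => |x|) atTop)
      (𝓝 (∫ _ in Ioc 0 T, (0 : ℝ))) := by
    refine tendsto_integral_filter_of_dominated_convergence (fun x => x ^ (α - 1) * B)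
      (Eventually.of_forall fun κ => (measurable_resolvent hα.1 κ).norm.aestronglyMeasurable)
      (Eventually.of_forall fun κ => ?_) ((integrableOn_rpow_sub_one hα.1 hT).mul_const B)
      ((ae_restrict_iff' measurableSet_Ioc).2 (ae_of_all _ fun x hx => ?_))
    · refine (ae_restrict_iff' measurableSet_Ioc).2 (ae_of_all _ fun x hx => ?_)
      rw [norm_norm]
      exact norm_resolvent_le hB κ hx.1.le
    · have hxα : 0 < x ^ α := Real.rpow_pos_of_pos hx.1 _
      have h1 : Tendsto (fun κ : ℝ => -(κ * x ^ α)) (comap (fun x => |x|) atTop)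
          (comap (fun x => |x|) atTop) := by
        refine tendsto_comap_iff.2 ?_
        have : ((fun x => |x|) ∘ fun κ : ℝ => -(κ * x ^ α)) = fun κ => |κ| * x ^ α := by
          ext κ; simp [abs_mul, abs_of_pos hxα]
        rw [this]
        exact tendsto_comap.atTop_mul_const hxα
      have h2 := (((tendsto_mittagLeffler hα).comp h1).const_mul ((x ^ (α - 1) : ℝ) : ℂ)).norm
      simpa using h2
  simpa using h

/-- Estimate at the final time for the scalar equation `∂^α f = -iκ f + c`, `f(0) = 0`. -/
theorem norm_le_of_hasCaputoDeriv {α T K κ : ℝ} (hα : α ∈ Ioo (0 : ℝ) 1) (hT : 0 < T)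
    {f c : ℝ → ℂ} (hf0 : f 0 = 0)
    (hf : HasCaputoDeriv α T f fun t => -Complex.I * (κ : ℂ) * f t + c t)
    (hK : 0 ≤ K) (hc : ∀ᵐ t ∂(volume.restrict (Ioo 0 T)), ‖c t‖ ≤ K) :
    ‖f T‖ ≤ K * resolventNorm α T κ := by
  obtain ⟨hfc, hint, hcap⟩ := hf
  have hfI : IntegrableOn f (Icc 0 T) := hfc.integrableOn_compact isCompact_Icc
  have hcI : IntegrableOn c (Icc 0 T) := by
    have h1 : IntegrableOn (fun t => -Complex.I * (κ : ℂ) * f t + c t) (Icc 0 T) := by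
      rw [integrableOn_Icc_iff_integrableOn_Ioc]
      exact (intervalIntegrable_iff_integrableOn_Ioc_of_le hT.le).1 hint
    have h2 := h1.sub (hfI.const_mul (-Complex.I * (κ : ℂ)))
    refine h2.congr (ae_of_all _ fun t => ?_)
    simp
  have hsub : ∀ {g : ℝ → ℂ}, IntegrableOn g (Icc 0 T) → ∀ s ∈ Icc 0 T, ∀ t ∈ Icc 0 T,
      IntervalIntegrable g volume s t := fun hg s hs t ht =>
    (hg.mono_set (uIcc_subset_Icc hs ht)).intervalIntegrable
  have hzero : (0 : ℝ) ∈ Icc 0 T := ⟨le_rfl, hT.le⟩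
  set z : ℂ := -Complex.I * κ with hz
  -- The argument runs on primitives. The Caputo equation reads $I^{1-\alpha}f=C+zD$, and applying
  -- $I^\alpha$ gives the Volterra equation $D=I^\alpha(C+zD)$ with continuous data, although $c$ is
  -- only bounded almost everywhere.
  set C : ℝ → ℂ := fun t => ∫ s in (0 : ℝ)..t, c s with hCdef
  set D : ℝ → ℂ := fun t => ∫ s in (0 : ℝ)..t, f s with hDdef
  have hCc : ContinuousOn C (Icc 0 T) :=
    intervalIntegral.continuousOn_primitive_interval (by rwa [uIcc_of_le hT.le])
      |>.mono (by rw [uIcc_of_le hT.le])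
  have hDc : ContinuousOn D (Icc 0 T) :=
    intervalIntegral.continuousOn_primitive_interval (by rwa [uIcc_of_le hT.le])
      |>.mono (by rw [uIcc_of_le hT.le])
  have hCD : ∀ t ∈ Icc 0 T, D t = fracIntegral α (fun s => C s + z * D s) t := by
    intro t ht
    have h1 : EqOn (fracIntegral (1 - α) f) (fun s => C s + z * D s) (Icc 0 T) := by
      intro s hs
      have h2 := hcap s hs
      simp only [hf0, sub_zero] at h2
      rw [h2, intervalIntegral.integral_add ((hsub hfI 0 hzero s hs).const_mul _)
        (hsub hcI 0 hzero s hs), intervalIntegral.integral_const_mul]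
      ring
    rw [← fracIntegral_congr h1 ht, fracIntegral_fracIntegral hα.1 (by linarith [hα.2]) hfc ht,
      add_sub_cancel, fracIntegral_one]
  have hClip : ∀ s ∈ Icc 0 T, ∀ t ∈ Icc 0 T, ‖C s - C t‖ ≤ K * |s - t| := by
    intro s hs t ht
    rw [hCdef]
    simp only
    rw [intervalIntegral.integral_interval_sub_left (hsub hcI 0 hzero s hs) (hsub hcI 0 hzero t ht)]
    refine intervalIntegral.norm_integral_le_of_norm_le_const_ae ?_
    rw [ae_restrict_iff' measurableSet_Ioo] at hc
    have hT' : ∀ᵐ x : ℝ, x ≠ T := by simp [ae_iff]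
    filter_upwards [hc, hT'] with x hx hxT hxm
    have h1 := (uIoc_subset_uIcc hxm)
    have h2 := uIcc_subset_Icc ht hs h1
    refine hx ⟨lt_of_le_of_ne h2.1 ?_, lt_of_le_of_ne h2.2 hxT⟩
    intro h0
    rw [mem_uIoc] at hxm
    rcases hxm with h | h
    · linarith [h.1, ht.1]
    · linarith [h.1, hs.1]
  have hrep : ∀ t ∈ Icc 0 T, D t = ∫ x in Ioc 0 T, (((x ^ (α - 1) : ℝ) : ℂ) *
      mittagLeffler α (((-(κ * x ^ α) : ℝ) : ℂ) * Complex.I)) * C (max (t - x) 0) := by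
    intro t ht
    rw [volterra_representation hα.1 hCc hDc (by simp [hCdef]) (by simp [hDdef]) hCD ht]
    refine setIntegral_congr_fun measurableSet_Ioc fun x _ => ?_
    congr 3
    rw [hz]
    push_cast
    ring
  have hmax : ∀ t ∈ Icc 0 T, ∀ x ∈ Ioc 0 T, max (t - x) 0 ∈ Icc 0 T := fun t ht x hx =>
    ⟨le_max_right _ _, max_le (by linarith [ht.2, hx.1]) hT.le⟩
  have hker := integrableOn_resolvent hα hT.le κ
  -- Convolution with the resolvent kernel multiplies the Lipschitz constant $K$ of $C$ by at most
  -- the $L^1$ norm of the kernel.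
  have hDlip : ∀ s ∈ Icc 0 T, ‖D T - D s‖ ≤ K * resolventNorm α T κ * (T - s) := by
    intro s hs
    obtain ⟨M, hM⟩ := isCompact_Icc.exists_bound_of_continuousOn hCc
    have hi : ∀ t ∈ Icc 0 T, IntegrableOn (fun x => (((x ^ (α - 1) : ℝ) : ℂ) *
        mittagLeffler α (((-(κ * x ^ α) : ℝ) : ℂ) * Complex.I)) * C (max (t - x) 0)) (Ioc 0 T) := by
      intro t ht
      refine hker.mul_bdd (c := M) ?_ ?_
      · have : ContinuousOn (fun x => C (max (t - x) 0)) (Ioc 0 T) :=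
          hCc.comp (by fun_prop) (hmax t ht)
        exact this.aestronglyMeasurable measurableSet_Ioc
      · exact (ae_restrict_iff' measurableSet_Ioc).2 (ae_of_all _ fun x hx => hM _ (hmax t ht x hx))
    have hTm : T ∈ Icc 0 T := ⟨hT.le, le_rfl⟩
    rw [hrep T hTm, hrep s hs, ← integral_sub (hi T hTm) (hi s hs)]
    have hbound : ∀ x ∈ Ioc 0 T, ‖(((x ^ (α - 1) : ℝ) : ℂ) *
        mittagLeffler α (((-(κ * x ^ α) : ℝ) : ℂ) * Complex.I)) * C (max (T - x) 0) -
        (((x ^ (α - 1) : ℝ) : ℂ) *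
        mittagLeffler α (((-(κ * x ^ α) : ℝ) : ℂ) * Complex.I)) * C (max (s - x) 0)‖ ≤
        ‖((x ^ (α - 1) : ℝ) : ℂ) * mittagLeffler α (((-(κ * x ^ α) : ℝ) : ℂ) * Complex.I)‖ *
          (K * (T - s)) := by
      intro x hx
      rw [← mul_sub, norm_mul]
      refine mul_le_mul_of_nonneg_left ((hClip _ (hmax T hTm x hx) _ (hmax s hs x hx)).trans
        (mul_le_mul_of_nonneg_left ?_ hK)) (norm_nonneg _)
      refine (abs_max_sub_max_le_abs _ _ _).trans_eq ?_
      rw [sub_sub_sub_cancel_right, abs_of_nonneg (by linarith [hs.2])]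
    refine (norm_integral_le_of_norm_le (hker.norm.mul_const _)
      ((ae_restrict_iff' measurableSet_Ioc).2 (ae_of_all _ hbound))).trans_eq ?_
    rw [integral_mul_const, resolventNorm]
    ring
  -- As $f$ is continuous up to $T$, the value $f(T)$ is the left derivative of $D$, so the
  -- Lipschitz bound on $D$ becomes a pointwise bound on $f(T)$.
  have hderiv : HasDerivWithinAt D (f T) (Iio T) T := by
    have h1 : StronglyMeasurableAtFilter f (𝓝[Iic T] T) volume := by
      refine ⟨Ioc 0 T, Ioc_mem_nhdsLE hT, (hfI.mono_set Ioc_subset_Icc_self).aestronglyMeasurable⟩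
    have h2 : ContinuousWithinAt f (Iic T) T :=
      (hfc T ⟨hT.le, le_rfl⟩).mono_of_mem_nhdsWithin (Icc_mem_nhdsLE hT)
    exact (intervalIntegral.integral_hasDerivWithinAt_right
      (hsub hfI 0 hzero T ⟨hT.le, le_rfl⟩) h1 h2).mono Iio_subset_Iic_self
  rw [hasDerivWithinAt_iff_tendsto_slope' (by simp)] at hderiv
  refine le_of_tendsto hderiv.norm ?_
  filter_upwards [Ioo_mem_nhdsLT hT] with s hs
  have h1 := hDlip s ⟨hs.1.le, hs.2.le⟩
  rw [slope_def_module, norm_smul, norm_inv, Real.norm_eq_abs, abs_sub_comm,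
    abs_of_pos (sub_pos.2 hs.2), norm_sub_rev, inv_mul_le_iff₀ (sub_pos.2 hs.2)]
  linarith

/-! ### Grid approximation of test functions in L², the core of Rellich's theorem. -/

lemma sq_lintegral_le {X : Type*} [MeasurableSpace X] (μ : Measure X) {f : X → ℝ≥0∞}
    (hf : AEMeasurable f μ) : (∫⁻ x, f x ∂μ) ^ 2 ≤ μ univ * ∫⁻ x, f x ^ 2 ∂μ := by
  have h := ENNReal.lintegral_mul_le_Lp_mul_Lq μ (p := 2) (q := 2)
    (by constructor <;> norm_num) hf (aemeasurable_const (b := (1 : ℝ≥0∞)))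
  simp only [Pi.mul_apply, mul_one, ENNReal.one_rpow, lintegral_const, one_mul] at h
  have h2 : ∀ a : ℝ≥0∞, (a ^ (1 / 2 : ℝ)) ^ 2 = a := fun a => by
    rw [← ENNReal.rpow_natCast, ← ENNReal.rpow_mul]; norm_num
  calc (∫⁻ x, f x ∂μ) ^ 2 ≤ _ := pow_le_pow_left' h 2
    _ = _ := by
      rw [mul_pow, h2, h2, mul_comm]
      norm_cast

/-- Translation estimate for continuously differentiable functions. -/
lemma lintegral_enorm_translate_sub_sq_le {d : ℕ} {φ : E d → ℂ} (hφ : ContDiff ℝ 1 φ) (h : E d) :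
    ∫⁻ x, ‖φ (x + h) - φ x‖ₑ ^ 2 ≤ ‖h‖ₑ ^ 2 * ∫⁻ x, ‖fderiv ℝ φ x‖ₑ ^ 2 := by
  have hD : Continuous (fderiv ℝ φ) := hφ.continuous_fderiv one_ne_zero
  have hpt : ∀ x, ‖φ (x + h) - φ x‖ₑ ^ 2 ≤
      ‖h‖ₑ ^ 2 * ∫⁻ s in Ioc (0 : ℝ) 1, ‖fderiv ℝ φ (x + s • h)‖ₑ ^ 2 := by
    intro x
    have hderiv : ∀ s ∈ uIcc (0 : ℝ) 1,
        HasDerivAt (fun s : ℝ => φ (x + s • h)) (fderiv ℝ φ (x + s • h) h) s := by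
      intro s _
      have h1 : HasDerivAt (fun s : ℝ => x + s • h) h s := by
        simpa using ((hasDerivAt_id s).smul_const h).const_add x
      exact ((hφ.differentiable one_ne_zero _).hasFDerivAt).comp_hasDerivAt s h1
    have hcont : Continuous fun s : ℝ => fderiv ℝ φ (x + s • h) h := by fun_prop
    have hFTC := intervalIntegral.integral_eq_sub_of_hasDerivAt hderiv
      (hcont.intervalIntegrable _ _)
    simp only [one_smul, zero_smul, add_zero] at hFTC
    rw [← hFTC, intervalIntegral.integral_of_le zero_le_one]
    have h2 : ‖∫ s in Ioc (0 : ℝ) 1, fderiv ℝ φ (x + s • h) h‖ₑ ≤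
        ‖h‖ₑ * ∫⁻ s in Ioc (0 : ℝ) 1, ‖fderiv ℝ φ (x + s • h)‖ₑ := by
      refine (enorm_integral_le_lintegral_enorm _).trans ?_
      rw [← lintegral_const_mul' _ _ (by simp)]
      refine lintegral_mono fun s => ?_
      rw [mul_comm]
      exact (fderiv ℝ φ (x + s • h)).le_opENorm h
    refine (pow_le_pow_left' h2 2).trans ?_
    rw [mul_pow]
    gcongr
    have h3 := sq_lintegral_le (volume.restrict (Ioc (0 : ℝ) 1))
      (f := fun s => ‖fderiv ℝ φ (x + s • h)‖ₑ)
      (by fun_prop : Continuous fun s : ℝ => ‖fderiv ℝ φ (x + s • h)‖ₑ).aemeasurable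
    simpa using h3
  have hmeas : Measurable (Function.uncurry fun (x : E d) (s : ℝ) =>
      ‖fderiv ℝ φ (x + s • h)‖ₑ ^ 2) := by
    refine Continuous.measurable ?_
    simp only [Function.uncurry_def]
    fun_prop
  calc ∫⁻ x, ‖φ (x + h) - φ x‖ₑ ^ 2
      ≤ ∫⁻ x, ‖h‖ₑ ^ 2 * ∫⁻ s in Ioc (0 : ℝ) 1, ‖fderiv ℝ φ (x + s • h)‖ₑ ^ 2 :=
        lintegral_mono hpt
    _ = ‖h‖ₑ ^ 2 * ∫⁻ x, ∫⁻ s in Ioc (0 : ℝ) 1, ‖fderiv ℝ φ (x + s • h)‖ₑ ^ 2 :=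
        lintegral_const_mul' _ _ (by simp)
    _ = ‖h‖ₑ ^ 2 * ∫⁻ s in Ioc (0 : ℝ) 1, ∫⁻ x, ‖fderiv ℝ φ (x + s • h)‖ₑ ^ 2 := by
        rw [lintegral_lintegral_swap hmeas.aemeasurable]
    _ = _ := by
        congr 1
        simp_rw [lintegral_add_right_eq_self (fun x => ‖fderiv ℝ φ x‖ₑ ^ 2)]
        simp

/-- Index of the half-open cube of side `δ` containing `x`. -/
noncomputable def cell {d : ℕ} (δ : ℝ) (x : E d) : Fin d → ℤ := fun i => ⌊x i / δ⌋

lemma measurable_cell {d : ℕ} (δ : ℝ) : Measurable (cell δ : E d → Fin d → ℤ) := by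
  refine measurable_pi_lambda _ fun i => ?_
  exact Int.measurable_floor.comp (by fun_prop)

lemma measurableSet_cell {d : ℕ} (δ : ℝ) (z : Fin d → ℤ) :
    MeasurableSet {x : E d | cell δ x = z} :=
  measurable_cell δ (measurableSet_singleton z)

lemma volume_cell {d : ℕ} {δ : ℝ} (hδ : 0 < δ) (z : Fin d → ℤ) :
    volume {x : E d | cell δ x = z} = ENNReal.ofReal (δ ^ d) := by
  have h1 : {x : E d | cell δ x = z} = (WithLp.ofLp : E d → Fin d → ℝ) ⁻¹'
      (Set.pi univ fun i => Ico (z i * δ) ((z i + 1) * δ)) := by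
    ext x
    simp only [mem_ofPred_eq, cell, mem_preimage, Set.mem_pi, mem_univ, true_imp_iff, mem_Ico,
      funext_iff, Int.floor_eq_iff, le_div_iff₀ hδ, div_lt_iff₀ hδ]
  rw [h1, (PiLp.volume_preserving_ofLp (Fin d)).measure_preimage
    (MeasurableSet.univ_pi fun _ => measurableSet_Ico).nullMeasurableSet, Real.volume_pi_Ico]
  have : ∀ i, ((z i : ℝ) + 1) * δ - z i * δ = δ := fun i => by ring
  simp [this, ENNReal.ofReal_pow hδ.le]

lemma norm_sub_le_of_cell_eq {d : ℕ} {δ : ℝ} (hδ : 0 < δ) {x y : E d} (h : cell δ x = cell δ y) :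
    ‖x - y‖ ≤ δ * d := by
  have h1 : ∀ i, |x i - y i| ≤ δ := by
    intro i
    have h2 := congrFun h i
    have h3 := Int.abs_sub_lt_one_of_floor_eq_floor h2
    rw [← sub_div, abs_div, abs_of_pos hδ, div_lt_one hδ] at h3
    exact h3.le
  rw [EuclideanSpace.norm_eq]
  refine Real.sqrt_le_iff.2 ⟨by positivity, ?_⟩
  calc ∑ i, ‖(x - y) i‖ ^ 2 ≤ ∑ _i : Fin d, δ ^ 2 := by
        refine Finset.sum_le_sum fun i _ => ?_
        rw [Real.norm_eq_abs]
        exact pow_le_pow_left₀ (abs_nonneg _) (h1 i) 2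
    _ = d * δ ^ 2 := by simp
    _ ≤ (δ * d) ^ 2 := by
      rcases Nat.eq_zero_or_pos d with h | h
      · simp [h]
      · have : (1 : ℝ) ≤ d := by exact_mod_cast h
        nlinarith [sq_nonneg δ]

/-- The mean of `φ` over the cube with index `z`. -/
noncomputable def cellMean {d : ℕ} (δ : ℝ) (φ : E d → ℂ) (z : Fin d → ℤ) : ℂ :=
  (δ ^ d)⁻¹ • ∫ y in {y : E d | cell δ y = z}, φ y

/-- The deviation from the mean is the mean of $\varphi(x)-\varphi(y)$ over the cube of $x$, and
that cube lies in the ball of radius $\delta d$ about $x$. Cauchy–Schwarz and Fubini leave the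
translation estimate; the $\delta^d$ in the ball's volume cancels that of the cube. -/
lemma lintegral_enorm_sub_cellMean_sq_le {d : ℕ} {φ : E d → ℂ} (hφ : ContDiff ℝ 1 φ)
    (hs : HasCompactSupport φ) {δ : ℝ} (hδ : 0 < δ) :
    ∫⁻ x, ‖φ x - cellMean δ φ (cell δ x)‖ₑ ^ 2 ≤
      volume (Metric.closedBall (0 : E d) d) * ENNReal.ofReal (δ * d) ^ 2 *
        ∫⁻ x, ‖fderiv ℝ φ x‖ₑ ^ 2 := by
  have hc := hφ.continuous
  have hint : Integrable φ := hc.integrable_of_hasCompactSupport hs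
  have hδd : 0 < δ ^ d := by positivity
  set V : ℝ≥0∞ := ENNReal.ofReal (δ ^ d) with hV
  have hV0 : V ≠ 0 := (ENNReal.ofReal_pos.2 hδd).ne'
  have hVt : V ≠ ∞ := ENNReal.ofReal_ne_top
  have hpt : ∀ x, ‖φ x - cellMean δ φ (cell δ x)‖ₑ ^ 2 ≤
      V⁻¹ * ∫⁻ h in Metric.closedBall (0 : E d) (δ * d), ‖φ (x + h) - φ x‖ₑ ^ 2 := by
    intro x
    set Q : Set (E d) := {y : E d | cell δ y = cell δ x} with hQ
    have hQm : MeasurableSet Q := measurableSet_cell δ _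
    have hQv : volume Q = V := volume_cell hδ _
    have h1 : φ x - cellMean δ φ (cell δ x) = (δ ^ d)⁻¹ • ∫ y in Q, (φ x - φ y) := by
      have hci : IntegrableOn (fun _ => φ x) Q := integrableOn_const (by rw [hQv]; exact hVt)
      rw [integral_sub hci hint.integrableOn, smul_sub, cellMean, setIntegral_const,
        measureReal_def, hQv, hV, ENNReal.toReal_ofReal hδd.le, smul_smul, inv_mul_cancel₀ hδd.ne',
        one_smul]
    have h2 : ‖((δ ^ d)⁻¹ : ℝ)‖ₑ = V⁻¹ := by
      rw [Real.enorm_eq_ofReal (by positivity), ENNReal.ofReal_inv_of_pos hδd]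
    have h3 : ‖∫ y in Q, (φ x - φ y)‖ₑ ^ 2 ≤ V * ∫⁻ y in Q, ‖φ x - φ y‖ₑ ^ 2 := by
      refine (pow_le_pow_left' (enorm_integral_le_lintegral_enorm _) 2).trans ?_
      have := sq_lintegral_le (volume.restrict Q) (f := fun y => ‖φ x - φ y‖ₑ)
        (by fun_prop : Continuous fun y => ‖φ x - φ y‖ₑ).aemeasurable
      rwa [Measure.restrict_apply_univ, hQv] at this
    have h4 : ∫⁻ y in Q, ‖φ x - φ y‖ₑ ^ 2 ≤
        ∫⁻ h in Metric.closedBall (0 : E d) (δ * d), ‖φ (x + h) - φ x‖ₑ ^ 2 := by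
      rw [← lintegral_indicator hQm, ← lintegral_indicator Metric.isClosed_closedBall.measurableSet,
        ← lintegral_add_left_eq_self _ x]
      refine lintegral_mono fun h => ?_
      by_cases hh : x + h ∈ Q
      · rw [indicator_of_mem hh, indicator_of_mem, ← enorm_neg, neg_sub]
        have := norm_sub_le_of_cell_eq hδ hh
        simpa using this
      · rw [indicator_of_notMem hh]; exact zero_le
    rw [h1, enorm_smul, h2, mul_pow]
    calc V⁻¹ ^ 2 * ‖∫ y in Q, (φ x - φ y)‖ₑ ^ 2
        ≤ V⁻¹ ^ 2 * (V * ∫⁻ h in Metric.closedBall (0 : E d) (δ * d), ‖φ (x + h) - φ x‖ₑ ^ 2) := by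
          gcongr
          exact h3.trans (by gcongr)
      _ = _ := by
          rw [pow_two, ← mul_assoc, mul_assoc V⁻¹, ENNReal.inv_mul_cancel hV0 hVt, mul_one]
  have hmeas : Measurable (Function.uncurry fun (x h : E d) => ‖φ (x + h) - φ x‖ₑ ^ 2) := by
    refine Continuous.measurable ?_
    simp only [Function.uncurry_def]
    fun_prop
  have hball : volume (Metric.closedBall (0 : E d) (δ * d)) =
      V * volume (Metric.closedBall (0 : E d) d) := by
    rw [Measure.addHaar_closedBall_mul_of_pos _ _ hδ]
    simp [hV]
  calc ∫⁻ x, ‖φ x - cellMean δ φ (cell δ x)‖ₑ ^ 2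
      ≤ ∫⁻ x, V⁻¹ * ∫⁻ h in Metric.closedBall (0 : E d) (δ * d), ‖φ (x + h) - φ x‖ₑ ^ 2 :=
        lintegral_mono hpt
    _ = V⁻¹ * ∫⁻ x, ∫⁻ h in Metric.closedBall (0 : E d) (δ * d), ‖φ (x + h) - φ x‖ₑ ^ 2 :=
        lintegral_const_mul' _ _ (ENNReal.inv_ne_top.2 hV0)
    _ = V⁻¹ * ∫⁻ h in Metric.closedBall (0 : E d) (δ * d), ∫⁻ x, ‖φ (x + h) - φ x‖ₑ ^ 2 := by
        rw [lintegral_lintegral_swap hmeas.aemeasurable]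
    _ ≤ V⁻¹ * ∫⁻ _ in Metric.closedBall (0 : E d) (δ * d),
          ENNReal.ofReal (δ * d) ^ 2 * ∫⁻ x, ‖fderiv ℝ φ x‖ₑ ^ 2 := by
        refine mul_le_mul_right (setLIntegral_mono' Metric.isClosed_closedBall.measurableSet
          fun h hh => (lintegral_enorm_translate_sub_sq_le hφ h).trans ?_) _
        gcongr
        rw [← ofReal_norm]
        exact ENNReal.ofReal_le_ofReal (by simpa using hh)
    _ = _ := by
        rw [setLIntegral_const, hball]
        rw [mul_comm _ (V * _), ← mul_assoc, ← mul_assoc V⁻¹, ENNReal.inv_mul_cancel hV0 hVt, one_mul,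
          mul_assoc]

lemma finite_cell_image {d : ℕ} {G : Set (E d)} (hG : Bornology.IsBounded G) {δ : ℝ} (hδ : 0 < δ) :
    (cell δ '' G).Finite := by
  obtain ⟨R, hR⟩ := hG.exists_norm_le
  refine (Set.Finite.pi' (fun _ : Fin d => Set.finite_Icc ⌊-R / δ⌋ ⌊R / δ⌋)).subset ?_
  rintro _ ⟨x, hx, rfl⟩ i
  have h1 : |x i| ≤ R := (by simpa using PiLp.norm_apply_le x i : |x i| ≤ ‖x‖).trans (hR x hx)
  rw [abs_le] at h1
  exact ⟨Int.floor_le_floor (by gcongr; exact h1.1), Int.floor_le_floor (by gcongr; exact h1.2)⟩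

lemma enorm_sq_eq_lintegral {X : Type*} [MeasurableSpace X] {μ : Measure X} (f : Lp ℂ 2 μ) :
    ‖f‖ₑ ^ 2 = ∫⁻ x, ‖f x‖ₑ ^ 2 ∂μ := by
  rw [Lp.enorm_def, eLpNorm_eq_lintegral_rpow_enorm_toReal (by simp) (by simp),
    ← ENNReal.rpow_natCast, ← ENNReal.rpow_mul]
  simp

lemma enorm_fderiv_sq_le {d : ℕ} (L : E d →L[ℝ] ℂ) :
    ‖L‖ₑ ^ 2 ≤ d * ∑ i, ‖L (EuclideanSpace.single i 1)‖ₑ ^ 2 := by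
  have h1 : ‖L‖ ≤ ∑ i, ‖L (EuclideanSpace.single i 1)‖ := by
    refine L.opNorm_le_bound (Finset.sum_nonneg fun i _ => norm_nonneg _) fun v => ?_
    have hv : v = ∑ i, v i • EuclideanSpace.single i (1 : ℝ) := by
      ext j
      simp [Finset.sum_apply, Pi.single_apply]
    have h2 : L v = ∑ i, v i • L (EuclideanSpace.single i 1) := by
      conv_lhs => rw [hv]
      simp
    rw [h2, Finset.sum_mul]
    refine norm_sum_le_of_le _ fun i _ => ?_
    rw [norm_smul, mul_comm]
    gcongr
    exact PiLp.norm_apply_le v i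
  have h3 : ‖L‖ ^ 2 ≤ d * ∑ i, ‖L (EuclideanSpace.single i 1)‖ ^ 2 := by
    refine (pow_le_pow_left₀ (norm_nonneg _) h1 2).trans ?_
    simpa using sq_sum_le_card_mul_sum_sq (s := Finset.univ)
      (f := fun i => ‖L (EuclideanSpace.single i 1)‖)
  simp only [← ofReal_norm]
  simp only [← ENNReal.ofReal_pow (norm_nonneg _)]
  rw [← ENNReal.ofReal_sum_of_nonneg (fun i _ => by positivity), ← ENNReal.ofReal_natCast,
    ← ENNReal.ofReal_mul (by positivity)]
  exact ENNReal.ofReal_le_ofReal h3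

/-- `L²`-approximation of test functions by functions that are constant on the cubes of a grid. -/
lemma exists_finiteDimensional_approx {d : ℕ} {G : Set (E d)} (hGo : MeasurableSet G)
    (hG : Bornology.IsBounded G) {ε : ℝ} (hε : 0 < ε) :
    ∃ U : Submodule ℂ (L2 G), FiniteDimensional ℂ U ∧
      ∀ p ∈ testGraph G, ∃ u ∈ U, ‖p.1 - u‖ ≤ ε * ∑ i, ‖p.2 i‖ := by
  obtain ⟨A, hA⟩ : ∃ A : ℝ, A = (volume (Metric.closedBall (0 : E d) d)).toReal := ⟨_, rfl⟩
  have hA0 : 0 ≤ A := hA ▸ ENNReal.toReal_nonneg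
  -- The factor $A(\delta d)^2$ comes from `lintegral_enorm_sub_cellMean_sq_le`, the last $d$ from
  -- bounding the operator norm of the derivative by its partial derivatives.
  obtain ⟨δ, hδ, hδε⟩ : ∃ δ : ℝ, 0 < δ ∧ A * (δ * d) ^ 2 * d ≤ ε ^ 2 := by
    have : Tendsto (fun δ : ℝ => A * (δ * d) ^ 2 * d) (𝓝[>] 0) (𝓝 0) := by
      have h : Continuous fun δ : ℝ => A * (δ * d) ^ 2 * d := by fun_prop
      simpa using (h.tendsto 0).mono_left nhdsWithin_le_nhds
    obtain ⟨δ, h1, h2⟩ := ((this.eventually_lt_const (by positivity : 0 < ε ^ 2)).and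
      self_mem_nhdsWithin).exists
    exact ⟨δ, h2, h1.le⟩
  have hfin := finite_cell_image hG hδ
  have hQt : ∀ z : Fin d → ℤ, (volume.restrict G) {x : E d | cell δ x = z} ≠ ∞ := fun z =>
    ((Measure.restrict_apply_le _ _).trans_lt (by rw [volume_cell hδ]; simp)).ne
  set e : (Fin d → ℤ) → L2 G := fun z =>
    indicatorConstLp 2 (measurableSet_cell δ z) (hQt z) (1 : ℂ) with he
  refine ⟨Submodule.span ℂ (e '' (cell δ '' G)),
    FiniteDimensional.span_of_finite ℂ (hfin.image e), ?_⟩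
  rintro ⟨w, g⟩ ⟨φ, hφ, hsupp, hsub, hw, hg⟩
  have hφ1 : ContDiff ℝ 1 φ := hφ.of_le (by exact_mod_cast le_top)
  refine ⟨∑ z ∈ hfin.toFinset, cellMean δ φ z • e z, ?_, ?_⟩
  · refine Submodule.sum_mem _ fun z hz => Submodule.smul_mem _ _ (Submodule.subset_span ?_)
    exact mem_image_of_mem _ (hfin.mem_toFinset.1 hz)
  set u : L2 G := ∑ z ∈ hfin.toFinset, cellMean δ φ z • e z with hu
  have hue : (u : E d → ℂ) =ᵐ[volume.restrict G] fun x => cellMean δ φ (cell δ x) := by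
    have h1 : ∀ᵐ x ∂(volume.restrict G), ∀ z ∈ hfin.toFinset, (cellMean δ φ z • e z : L2 G) x =
        cellMean δ φ z * ({x : E d | cell δ x = z}.indicator (fun _ => (1 : ℂ)) x) := by
      refine (ae_ball_iff hfin.toFinset.countable_toSet).2 fun z _ => ?_
      filter_upwards [Lp.coeFn_smul (cellMean δ φ z) (e z),
        indicatorConstLp_coeFn (p := 2) (hs := measurableSet_cell δ z) (hμs := hQt z)
          (c := (1 : ℂ))] with x h1 h2
      rw [h1, Pi.smul_apply, he, h2, smul_eq_mul]
    have h2 : (u : E d → ℂ) =ᵐ[volume.restrict G]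
        ∑ z ∈ hfin.toFinset, ((cellMean δ φ z • e z : L2 G) : E d → ℂ) := Lp.coeFn_finsetSum _ _
    filter_upwards [h1, h2, ae_restrict_mem hGo] with x h1 h2 hx
    rw [h2, Finset.sum_apply, Finset.sum_congr rfl h1, Finset.sum_eq_single (cell δ x)]
    · simp
    · intro z _ hz
      rw [indicator_of_notMem (by exact fun h => hz h.symm), mul_zero]
    · intro h
      exact absurd (hfin.mem_toFinset.2 (mem_image_of_mem _ hx)) h
  have hgrad : ∫⁻ x, ‖fderiv ℝ φ x‖ₑ ^ 2 ≤ d * ∑ i, ‖g i‖ₑ ^ 2 := by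
    have h1 : ∫⁻ x, ‖fderiv ℝ φ x‖ₑ ^ 2 = ∫⁻ x in G, ‖fderiv ℝ φ x‖ₑ ^ 2 := by
      rw [← lintegral_indicator hGo]
      congr 1
      ext x
      by_cases hx : x ∈ G
      · rw [indicator_of_mem hx]
      · have : fderiv ℝ φ x = 0 :=
          image_eq_zero_of_notMem_tsupport fun h => hx (hsub (tsupport_fderiv_subset ℝ h))
        rw [indicator_of_notMem hx, this, ← ofReal_norm, norm_zero]
        simp
    rw [h1]
    calc ∫⁻ x in G, ‖fderiv ℝ φ x‖ₑ ^ 2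
        ≤ ∫⁻ x in G, d * ∑ i, ‖fderiv ℝ φ x (EuclideanSpace.single i 1)‖ₑ ^ 2 :=
          lintegral_mono fun x => enorm_fderiv_sq_le _
      _ = d * ∑ i, ∫⁻ x in G, ‖fderiv ℝ φ x (EuclideanSpace.single i 1)‖ₑ ^ 2 := by
          have hc : Continuous (fderiv ℝ φ) := hφ1.continuous_fderiv one_ne_zero
          rw [lintegral_const_mul' _ _ (by simp), lintegral_finsetSum _ fun i _ => ?_]
          exact Continuous.measurable (by fun_prop)
      _ = _ := by
          congr 1
          refine Finset.sum_congr rfl fun i _ => ?_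
          rw [enorm_sq_eq_lintegral]
          refine lintegral_congr_ae ?_
          filter_upwards [hg i] with x hx
          rw [hx]
  have hmain : ‖w - u‖ₑ ^ 2 ≤ ENNReal.ofReal (ε ^ 2) * ∑ i, ‖g i‖ₑ ^ 2 := by
    calc ‖w - u‖ₑ ^ 2 = ∫⁻ x in G, ‖φ x - cellMean δ φ (cell δ x)‖ₑ ^ 2 := by
          rw [enorm_sq_eq_lintegral]
          refine lintegral_congr_ae ?_
          filter_upwards [Lp.coeFn_sub w u, hw, hue] with x h1 h2 h3
          have h4 : w x = φ x := h2
          rw [h1, Pi.sub_apply, h4, h3]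
      _ ≤ ∫⁻ x, ‖φ x - cellMean δ φ (cell δ x)‖ₑ ^ 2 := setLIntegral_le_lintegral _ _
      _ ≤ volume (Metric.closedBall (0 : E d) d) * ENNReal.ofReal (δ * d) ^ 2 *
            (d * ∑ i, ‖g i‖ₑ ^ 2) :=
          (lintegral_enorm_sub_cellMean_sq_le hφ1 hsupp hδ).trans (by gcongr)
      _ = ENNReal.ofReal (A * (δ * d) ^ 2 * d) * ∑ i, ‖g i‖ₑ ^ 2 := by
          rw [ENNReal.ofReal_mul (p := A * (δ * d) ^ 2) (by positivity),
            ENNReal.ofReal_mul (p := A) hA0, hA, ENNReal.ofReal_toReal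
            (isCompact_closedBall _ _).measure_lt_top.ne, ENNReal.ofReal_pow (by positivity),
            ENNReal.ofReal_natCast]
          ring
      _ ≤ _ := by gcongr
  have hreal : ‖w - u‖ ^ 2 ≤ ε ^ 2 * ∑ i, ‖g i‖ ^ 2 := by
    simp only [← ofReal_norm] at hmain
    simp only [← ENNReal.ofReal_pow (norm_nonneg _)] at hmain
    rw [← ENNReal.ofReal_sum_of_nonneg (fun i _ => by positivity),
      ← ENNReal.ofReal_mul (by positivity)] at hmain
    exact (ENNReal.ofReal_le_ofReal_iff (by positivity)).1 hmain
  refine abs_le_of_sq_le_sq' ?_ (by positivity) |>.2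
  refine hreal.trans ?_
  rw [mul_pow]
  gcongr
  exact Finset.sum_sq_le_sq_sum_of_nonneg fun i _ => norm_nonneg _

/-! ### Small eigenvalues of compact self-adjoint operators. -/

section Spectral

variable {H : Type*} [NormedAddCommGroup H] [InnerProductSpace ℂ H] [CompleteSpace H]

/-- Being bounded below, $R$ is a closed embedding, so the unit ball is a closed subset of the
preimage of a compact set; a space with compact unit ball is finite-dimensional. -/
lemma finiteDimensional_of_isCompactOperator_of_bound {R : H →L[ℂ] H} (hR : IsCompactOperator R)
    {δ : ℝ} (hδ : 0 < δ) (h : ∀ x, δ * ‖x‖ ≤ ‖R x‖) : FiniteDimensional ℂ H := by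
  have hanti : AntilipschitzWith (Real.toNNReal δ⁻¹) R := by
    refine ContinuousLinearMap.antilipschitz_of_bound R fun x => ?_
    rw [Real.coe_toNNReal _ (by positivity), ← div_eq_inv_mul, le_div_iff₀ hδ, mul_comm]
    exact h x
  have hemb : IsClosedEmbedding R := hanti.isClosedEmbedding R.uniformContinuous
  obtain ⟨K, hK, hsub⟩ := hR.image_closedBall_subset_compact (f := (R : H →ₗ[ℂ] H)) 1
  refine FiniteDimensional.of_isCompact_closedBall₀ ℂ (r := 1) one_pos ?_
  exact (hemb.isCompact_preimage hK).of_isClosed_subset Metric.isClosed_closedBall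
    (image_subset_iff.1 hsub)

/-- In infinite dimensions, the eigenvalues of an injective compact self-adjoint operator
accumulate at `0`. -/
lemma exists_hasEigenvalue_norm_lt {R : H →L[ℂ] H} (hR : IsCompactOperator R)
    (hsym : (R : H →ₗ[ℂ] H).IsSymmetric) (hinf : ¬ FiniteDimensional ℂ H) {δ : ℝ} (hδ : 0 < δ) :
    ∃ μ : ℂ, Module.End.HasEigenvalue (R : Module.End ℂ H) μ ∧ ‖μ‖ < δ := by
  classical
  -- If every eigenvalue had modulus at least $\delta$, orthogonality of the eigenspaces would give
  -- $\|Rx\|\ge\delta\|x\|$ on their span, hence everywhere, since the span is dense by the spectral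
  -- theorem.
  by_contra! hcon
  refine hinf (finiteDimensional_of_isCompactOperator_of_bound hR hδ ?_)
  have hdense : Dense ((⨆ μ, Module.End.eigenspace (R : Module.End ℂ H) μ : Submodule ℂ H) : Set H) := by
    rw [Submodule.dense_iff_topologicalClosure_eq_top, Submodule.topologicalClosure_eq_top_iff]
    exact ContinuousLinearMap.orthogonalComplement_iSup_eigenspaces_eq_bot hR hsym
  have hclosed : IsClosed {x : H | δ * ‖x‖ ≤ ‖R x‖} :=
    isClosed_le (by fun_prop) (by fun_prop)
  intro x
  refine hclosed.closure_subset_iff.2 ?_ (hdense x)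
  intro x hx
  obtain ⟨f, rfl⟩ := (Submodule.mem_iSup_iff_exists_dfinsupp' _ x).1 hx
  have hfam := hsym.orthogonalFamily_eigenspaces
  have hnorm := hfam.norm_sum (fun i => f i) f.support
  have hnormR := hfam.norm_sum (fun i => (i • f i : Module.End.eigenspace (R : Module.End ℂ H) i))
    f.support
  have hRx : R (f.sum fun _ y => (y : H)) =
      ∑ i ∈ f.support, (Module.End.eigenspace (R : Module.End ℂ H) i).subtypeₗᵢ (i • f i) := by
    rw [DFinsupp.sum, map_sum]
    refine Finset.sum_congr rfl fun i _ => ?_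
    have := Module.End.mem_eigenspace_iff.1 (f i).2
    simpa using this
  have hle : (δ * ‖f.sum fun _ y => (y : H)‖) ^ 2 ≤ ‖R (f.sum fun _ y => (y : H))‖ ^ 2 := by
    rw [hRx, hnormR, mul_pow]
    have h1 : ‖f.sum fun _ y => (y : H)‖ ^ 2 = ∑ i ∈ f.support, ‖f i‖ ^ 2 := hnorm
    rw [h1, Finset.mul_sum]
    refine Finset.sum_le_sum fun i hi => ?_
    rw [norm_smul, mul_pow]
    have hne : f i ≠ 0 := DFinsupp.mem_support_iff.1 hi
    have hev : Module.End.HasEigenvalue (R : Module.End ℂ H) i := by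
      refine Module.End.hasEigenvalue_of_hasEigenvector (x := (f i : H)) ⟨(f i).2, ?_⟩
      simpa using hne
    have := hcon i hev
    gcongr
  exact abs_le_of_sq_le_sq' hle (norm_nonneg _) |>.2

/-- Eigenvalues of `J J*` for a compact operator `J` with dense range. -/
lemma exists_small_eigenvalue {V : Type*} [NormedAddCommGroup V] [InnerProductSpace ℂ V]
    [CompleteSpace V] {J : V →L[ℂ] H} (hJ : IsCompactOperator J)
    (hdense : ∀ v, (∀ p, inner ℂ (J p) v = 0) → v = 0) (hinf : ¬ FiniteDimensional ℂ H)
    {δ : ℝ} (hδ : 0 < δ) :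
    ∃ (m : ℝ) (v : H) (q : V), 0 < m ∧ m < δ ∧ ‖v‖ = 1 ∧ J q = (m : ℂ) • v ∧
      ∀ p, inner ℂ q p = inner ℂ v (J p) := by
  set R : H →L[ℂ] H := J ∘L ContinuousLinearMap.adjoint J with hR
  have hinner : ∀ v w, inner ℂ v (R w) = inner ℂ (ContinuousLinearMap.adjoint J v)
      (ContinuousLinearMap.adjoint J w) := fun v w =>
    (ContinuousLinearMap.adjoint_inner_left J _ v).symm
  have hsym : (R : H →ₗ[ℂ] H).IsSymmetric := by
    intro v w
    change inner ℂ (R v) w = inner ℂ v (R w)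
    rw [hinner, ← inner_conj_symm, hinner, inner_conj_symm]
  have hcomp : IsCompactOperator R := hJ.comp_clm (ContinuousLinearMap.adjoint J)
  obtain ⟨μ, hμ, hμlt⟩ := exists_hasEigenvalue_norm_lt hcomp hsym hinf hδ
  obtain ⟨v₀, hv₀, hv₀ne⟩ := hμ.exists_hasEigenvector
  set v : H := ((‖v₀‖⁻¹ : ℝ) : ℂ) • v₀ with hv
  have hv1 : ‖v‖ = 1 := by
    rw [hv, norm_smul, Complex.norm_real, norm_inv, norm_norm,
      inv_mul_cancel₀ (norm_ne_zero_iff.2 hv₀ne)]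
  have hRv : R v = μ • v := by
    have : R v₀ = μ • v₀ := Module.End.mem_eigenspace_iff.1 hv₀
    rw [hv, map_smul, this, smul_comm]
  set q : V := ContinuousLinearMap.adjoint J v with hq
  have hqp : ∀ p, inner ℂ q p = inner ℂ v (J p) := fun p =>
    ContinuousLinearMap.adjoint_inner_left J p v
  -- Pairing $JJ^*v=\mu v$ with the unit vector $v$ gives $\mu=\|J^*v\|^2$; it is positive because
  -- dense range makes $J^*$ injective.
  have hμm : μ = ((‖q‖ ^ 2 : ℝ) : ℂ) := by
    have h1 := hinner v v
    rw [hRv, inner_smul_right, inner_self_eq_norm_sq_to_K, hv1, inner_self_eq_norm_sq_to_K] at h1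
    simpa using h1
  have hq0 : q ≠ 0 := fun h => by
    have : v = 0 := hdense v fun p => by
      rw [← inner_conj_symm, ← hqp, h, inner_zero_left, map_zero]
    rw [this] at hv1
    simp at hv1
  have hm0 : 0 < ‖q‖ ^ 2 := by
    have := norm_pos_iff.2 hq0
    positivity
  refine ⟨‖q‖ ^ 2, v, q, hm0, ?_, hv1, ?_, hqp⟩
  · rwa [hμm, Complex.norm_real, Real.norm_of_nonneg hm0.le] at hμlt
  · rw [← hμm, ← hRv]; rfl

end Spectral

/-! ### The Hilbert space H¹₀, its compact embedding and Dirichlet eigenfunctions. -/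

section Sobolev

variable {d : ℕ}

/-- The test graph as a subspace of `L²(G) × L²(G)^d`. -/
def testSubmodule (G : Set (E d)) : Submodule ℂ (L2 G × (Fin d → L2 G)) where
  carrier := testGraph G
  zero_mem' := by
    refine ⟨0, contDiff_const, HasCompactSupport.zero, by simp [tsupport], Lp.coeFn_zero _ _ _,
      fun i => ?_⟩
    filter_upwards [Lp.coeFn_zero ℂ 2 (volume.restrict G)] with x hx
    simpa using hx
  add_mem' := by
    rintro p q ⟨φ, hφ, hφc, hφs, hp, hp'⟩ ⟨ψ, hψ, hψc, hψs, hq, hq'⟩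
    refine ⟨φ + ψ, hφ.add hψ, hφc.add hψc, (tsupport_add φ ψ).trans (union_subset hφs hψs), ?_,
      fun i => ?_⟩
    · filter_upwards [Lp.coeFn_add p.1 q.1, hp, hq] with x h1 h2 h3
      rw [Prod.fst_add, h1, Pi.add_apply, Pi.add_apply, h2, h3]
    · filter_upwards [Lp.coeFn_add (p.2 i) (q.2 i), hp' i, hq' i] with x h1 h2 h3
      rw [Prod.snd_add, Pi.add_apply, h1, Pi.add_apply, h2, h3,
        fderiv_add (hφ.differentiable (by simp) x) (hψ.differentiable (by simp) x)]
      rfl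
  smul_mem' := by
    rintro c p ⟨φ, hφ, hφc, hφs, hp, hp'⟩
    refine ⟨c • φ, contDiff_const.smul hφ, hφc.smul_left (f := fun _ => c),
      (tsupport_smul_subset_right (fun _ => c) φ).trans hφs, ?_, fun i => ?_⟩
    · filter_upwards [Lp.coeFn_smul c p.1, hp] with x h1 h2
      rw [Prod.smul_fst, h1, Pi.smul_apply, Pi.smul_apply, h2]
    · filter_upwards [Lp.coeFn_smul c (p.2 i), hp' i] with x h1 h2
      rw [Prod.smul_snd, Pi.smul_apply, h1, Pi.smul_apply, h2,
        fderiv_const_smul (hφ.differentiable (by simp) x)]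
      rfl

/-- The Hilbert space `L²(G) × L²(G)^d`. -/
abbrev GradSpace (G : Set (E d)) : Type := WithLp 2 (L2 G × PiLp 2 (fun _ : Fin d => L2 G))

/-- The identity from the Hilbert space `L²(G) × L²(G)^d` to the product. -/
noncomputable def gradEquiv (G : Set (E d)) : GradSpace G ≃L[ℂ] L2 G × (Fin d → L2 G) :=
  (WithLp.prodContinuousLinearEquiv 2 ℂ _ _).trans
    ((ContinuousLinearEquiv.refl ℂ _).prodCongr (PiLp.continuousLinearEquiv 2 ℂ _))

lemma norm_snd_gradEquiv_le {G : Set (E d)} (p : GradSpace G) (i : Fin d) :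
    ‖(gradEquiv G p).2 i‖ ≤ ‖p‖ :=
  (PiLp.norm_apply_le p.snd i).trans (WithLp.norm_snd_le _ p)

/-- The Sobolev space `H¹₀(G)` as a Hilbert space. -/
noncomputable def sobolev (G : Set (E d)) : Submodule ℂ (GradSpace G) :=
  (testSubmodule G).topologicalClosure.comap (gradEquiv G : GradSpace G →ₗ[ℂ] L2 G × (Fin d → L2 G))

lemma mem_sobolev {G : Set (E d)} {p : GradSpace G} : p ∈ sobolev G ↔ gradEquiv G p ∈ H10 G :=
  Iff.rfl

/-- The Sobolev space `H¹₀(G)` as a type. -/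
def SobolevSpace (G : Set (E d)) : Type := sobolev G

noncomputable instance (G : Set (E d)) : NormedAddCommGroup (SobolevSpace G) :=
  inferInstanceAs (NormedAddCommGroup (sobolev G))

noncomputable instance (G : Set (E d)) : InnerProductSpace ℂ (SobolevSpace G) :=
  inferInstanceAs (InnerProductSpace ℂ (sobolev G))

instance (G : Set (E d)) : CompleteSpace (SobolevSpace G) := by
  have h : IsClosed (sobolev G : Set (GradSpace G)) :=
    (testSubmodule G).isClosed_topologicalClosure.preimage (gradEquiv G).continuous
  exact h.completeSpace_coe

/-- A pair `(w, ∇w)` as an element of the Sobolev space. -/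
noncomputable def SobolevSpace.mk {G : Set (E d)} (p : L2 G × (Fin d → L2 G)) (hp : p ∈ H10 G) :
    SobolevSpace G :=
  ⟨(gradEquiv G).symm p, by rwa [mem_sobolev, ContinuousLinearEquiv.apply_symm_apply]⟩

/-- The pair `(w, ∇w)` of an element of the Sobolev space. -/
noncomputable def SobolevSpace.toProd (G : Set (E d)) :
    SobolevSpace G →ₗ[ℂ] L2 G × (Fin d → L2 G) :=
  (gradEquiv G : GradSpace G →ₗ[ℂ] L2 G × (Fin d → L2 G)) ∘ₗ (sobolev G).subtype

lemma SobolevSpace.toProd_mem {G : Set (E d)} (p : SobolevSpace G) : toProd G p ∈ H10 G :=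
  mem_sobolev.1 (Subtype.property (p := (· ∈ sobolev G)) p)

lemma SobolevSpace.toProd_mk {G : Set (E d)} (p : L2 G × (Fin d → L2 G)) (hp : p ∈ H10 G) :
    toProd G (mk p hp) = p := (gradEquiv G).apply_symm_apply p

lemma SobolevSpace.inner_eq {G : Set (E d)} (p q : SobolevSpace G) :
    inner ℂ p q = inner ℂ (toProd G p).1 (toProd G q).1 +
      ∑ i, inner ℂ ((toProd G p).2 i) ((toProd G q).2 i) := rfl

lemma SobolevSpace.norm_fst_le {G : Set (E d)} (p : SobolevSpace G) : ‖(toProd G p).1‖ ≤ ‖p‖ :=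
  WithLp.norm_fst_le _ (p : sobolev G).1

lemma SobolevSpace.norm_snd_le {G : Set (E d)} (p : SobolevSpace G) (i : Fin d) :
    ‖(toProd G p).2 i‖ ≤ ‖p‖ :=
  norm_snd_gradEquiv_le (p : sobolev G).1 i

open SobolevSpace

/-- The embedding of `H¹₀(G)` into `L²(G)`. -/
noncomputable def embed (G : Set (E d)) : SobolevSpace G →L[ℂ] L2 G :=
  LinearMap.mkContinuous (LinearMap.fst ℂ (L2 G) (Fin d → L2 G) ∘ₗ toProd G) 1
    fun p => by simpa using norm_fst_le p

lemma embed_apply {G : Set (E d)} (p : SobolevSpace G) : embed G p = (toProd G p).1 := rfl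

/-- Rellich's theorem. -/
lemma isCompactOperator_embed {G : Set (E d)} (hGo : MeasurableSet G)
    (hG : Bornology.IsBounded G) : IsCompactOperator (embed G) := by
  have happ : ∀ n : ℕ, ∃ F : SobolevSpace G →L[ℂ] L2 G, IsCompactOperator F ∧
      ‖F - embed G‖ ≤ 1 / ((n : ℝ) + 1) * d := by
    intro n
    have hε : 0 < 1 / ((n : ℝ) + 1) := by positivity
    obtain ⟨U, hU, happ⟩ := exists_finiteDimensional_approx hGo hG hε
    -- The estimate, phrased with the orthogonal projection onto $U$, is a closed condition on the
    -- pair and so passes from test functions to $H^1_0$. The embedding is then a norm limit of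
    -- finite-rank operators.
    have hclosed : IsClosed {p : L2 G × (Fin d → L2 G) |
        ‖U.starProjection p.1 - p.1‖ ≤ 1 / ((n : ℝ) + 1) * ∑ i, ‖p.2 i‖} :=
      isClosed_le (by fun_prop) (by fun_prop)
    have hH10 : ∀ p ∈ H10 G, ‖U.starProjection p.1 - p.1‖ ≤ 1 / ((n : ℝ) + 1) * ∑ i, ‖p.2 i‖ := by
      refine fun p hp => hclosed.closure_subset_iff.2 (fun q hq => ?_) hp
      obtain ⟨u, hu, hle⟩ := happ q hq
      refine le_trans ?_ hle
      rw [norm_sub_rev, U.starProjection_minimal]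
      exact ciInf_le ⟨0, by rintro _ ⟨y, rfl⟩; exact norm_nonneg _⟩ (⟨u, hu⟩ : U)
    refine ⟨U.starProjection ∘L embed G, ?_, ?_⟩
    · have h1 : IsCompactOperator (U.orthogonalProjectionOnto ∘L embed G) :=
        by
        have : ProperSpace U := FiniteDimensional.proper ℂ U
        exact isCompactOperator_of_locallyCompactSpace_dom _
      exact h1.clm_comp U.subtypeL
    · refine ContinuousLinearMap.opNorm_le_bound _ (by positivity) fun p => ?_
      refine (hH10 _ (toProd_mem p)).trans ?_
      rw [mul_assoc]
      refine mul_le_mul_of_nonneg_left ?_ hε.le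
      calc ∑ i, ‖(toProd G p).2 i‖ ≤ ∑ _i : Fin d, ‖p‖ :=
            Finset.sum_le_sum fun i _ => norm_snd_le p i
        _ = d * ‖p‖ := by simp
  choose F hF hle using happ
  refine isCompactOperator_of_tendsto (F := F) (l := atTop) ?_ (Eventually.of_forall hF)
  rw [tendsto_iff_norm_sub_tendsto_zero]
  refine squeeze_zero (fun _ => norm_nonneg _) hle ?_
  simpa using (tendsto_one_div_add_atTop_nhds_zero_nat (𝕜 := ℝ)).mul_const (d : ℝ)

/-- Density of test functions, via the fundamental lemma of the calculus of variations; real-valued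
ones suffice. -/
lemma eq_zero_of_forall_inner_embed_eq_zero {G : Set (E d)} (hGo : IsOpen G)
    (hG : Bornology.IsBounded G) {v : L2 G}
    (hv : ∀ p, inner ℂ (embed G p) v = 0) : v = 0 := by
  have hfin : IsFiniteMeasure ((volume : Measure (E d)).restrict G) :=
    ⟨by rw [Measure.restrict_apply_univ]; exact hG.measure_lt_top⟩
  have hloc : LocallyIntegrableOn (v : E d → ℂ) G :=
    IntegrableOn.locallyIntegrableOn ((Lp.memLp v).integrable (by norm_num))
  have hae := hGo.ae_eq_zero_of_integral_contDiff_smul_eq_zero hloc (fun g hg hgc hgs => ?_)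
  · rw [Lp.eq_zero_iff_ae_eq_zero]
    exact (ae_restrict_iff' hGo.measurableSet).2 hae
  set φ : E d → ℂ := fun x => (g x : ℂ) with hφdef
  have hφ : ContDiff ℝ ((⊤ : ℕ∞) : WithTop ℕ∞) φ := Complex.ofRealCLM.contDiff.comp hg
  have hφc : HasCompactSupport φ := hgc.comp_left (g := Complex.ofReal) rfl
  have hφs : tsupport φ ⊆ G := (closure_mono (fun x hx => by
    simpa [hφdef] using hx)).trans hgs
  have hm : MemLp φ 2 (volume.restrict G) :=
    (hφ.continuous.memLp_of_hasCompactSupport hφc).restrict G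
  have hm' : ∀ i : Fin d, MemLp (fun x => fderiv ℝ φ x (EuclideanSpace.single i 1)) 2
      (volume.restrict G) := fun i => by
    have hc : Continuous fun x => fderiv ℝ φ x (EuclideanSpace.single i 1) := by
      have := hφ.continuous_fderiv (by simp)
      fun_prop
    refine (hc.memLp_of_hasCompactSupport ?_).restrict G
    exact (hφc.fderiv ℝ).comp_left (g := fun L : E d →L[ℝ] ℂ => L (EuclideanSpace.single i 1)) rfl
  set p : L2 G × (Fin d → L2 G) := (hm.toLp φ, fun i => (hm' i).toLp _) with hp
  have hpt : p ∈ testGraph G :=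
    ⟨φ, hφ, hφc, hφs, hm.coeFn_toLp, fun i => (hm' i).coeFn_toLp⟩
  have h0 : inner ℂ (hm.toLp φ) v = 0 := by
    have hp10 : p ∈ H10 G := subset_closure hpt
    have h1 := hv (SobolevSpace.mk p hp10)
    rwa [embed_apply, toProd_mk] at h1
  rw [L2.inner_def] at h0
  have h2 : ∫ x in G, g x • v x = 0 := by
    rw [← h0]
    refine integral_congr_ae ?_
    filter_upwards [hm.coeFn_toLp] with x hx
    rw [hx]
    simp [hφdef, mul_comm]
  rw [← h2]
  symm
  refine setIntegral_eq_integral_of_forall_compl_eq_zero fun x hx => ?_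
  rw [image_eq_zero_of_notMem_tsupport (fun h => hx (hgs h)), zero_smul]

/-- Indicators of infinitely many disjoint nonempty open subsets are orthogonal and nonzero. In
dimension $0$ the set $G$ would be one point. -/
lemma not_finiteDimensional_L2 (hd : 1 ≤ d) {G : Set (E d)} (hGo : IsOpen G) (hne : G.Nonempty)
    (hG : Bornology.IsBounded G) : ¬ FiniteDimensional ℂ (L2 G) := by
  have : NeZero d := ⟨by omega⟩
  obtain ⟨x, hx⟩ := hne
  have hinf : Infinite G := (infinite_of_mem_nhds x (hGo.mem_nhds hx)).to_subtype
  obtain ⟨U, hUi, hUo, hUd⟩ := exists_seq_infinite_isOpen_pairwise_disjoint G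
  have hVo : ∀ n, IsOpen ((↑) '' U n : Set (E d)) := fun n => hGo.isOpenMap_subtype_val _ (hUo n)
  have hVG : ∀ n, ((↑) '' U n : Set (E d)) ⊆ G := fun n => by
    rintro _ ⟨y, -, rfl⟩; exact y.2
  have hVd : Pairwise fun m n => Disjoint ((↑) '' U m : Set (E d)) ((↑) '' U n) := fun m n hmn =>
    (disjoint_image_iff Subtype.val_injective).2 (hUd hmn)
  have hfin : ∀ n, (volume.restrict G) ((↑) '' U n : Set (E d)) ≠ ∞ := fun n =>
    ((Measure.restrict_apply_le _ _).trans_lt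
      ((measure_mono (hVG n)).trans_lt hG.measure_lt_top)).ne
  have hpos : ∀ n, (volume.restrict G) ((↑) '' U n : Set (E d)) ≠ 0 := fun n => by
    rw [Measure.restrict_eq_self _ (hVG n)]
    exact ((hVo n).measure_pos _ ((hUi n).nonempty.image _)).ne'
  set e : ℕ → L2 G := fun n => indicatorConstLp 2 (hVo n).measurableSet (hfin n) (1 : ℂ) with he
  have hlin : LinearIndependent ℂ e := by
    refine linearIndependent_of_ne_zero_of_inner_eq_zero (fun n h => ?_) fun m n hmn => ?_
    · have h1 := congrArg (fun f : L2 G => ‖f‖) h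
      simp only [he, norm_zero] at h1
      rw [norm_indicatorConstLp (by simp) (by simp)] at h1
      have h2 := ENNReal.toReal_pos (hpos n) (hfin n)
      rw [measureReal_def] at h1
      have h3 := Real.rpow_pos_of_pos h2 (1 / (2 : ℝ≥0∞).toReal)
      simp only [norm_one, one_mul] at h1
      exact h3.ne' h1
    · simp only [he]
      rw [L2.inner_indicatorConstLp_one]
      refine integral_eq_zero_of_ae ?_
      rw [EventuallyEq, ae_restrict_iff' (hVo m).measurableSet]
      filter_upwards [indicatorConstLp_coeFn (p := 2) (hs := (hVo n).measurableSet)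
        (hμs := hfin n) (c := (1 : ℂ))] with x hx hxm
      rw [hx, indicator_of_notMem (fun h => (hVd hmn).ne_of_mem hxm h rfl)]
      rfl
  intro h
  exact not_finite_iff_infinite.2 inferInstance hlin.finite

/-- The Dirichlet Laplacian of a bounded open set has arbitrarily large eigenvalues. -/
theorem exists_dirichlet_eigenfunction (hd : 1 ≤ d) {G : Set (E d)} (hGo : IsOpen G)
    (hne : G.Nonempty) (hG : Bornology.IsBounded G) (Λ : ℝ) :
    ∃ (lam : ℝ) (v : L2 G) (h : Fin d → L2 G), Λ ≤ lam ∧ ‖v‖ = 1 ∧ (v, h) ∈ H10 G ∧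
      ∀ p ∈ H10 G, ∑ i, inner ℂ (h i) (p.2 i) = lam * inner ℂ v p.1 := by
  obtain ⟨m, v, q, hm0, hmlt, hv1, hJq, hqp⟩ := exists_small_eigenvalue
    (isCompactOperator_embed hGo.measurableSet hG)
    (fun v => eq_zero_of_forall_inner_embed_eq_zero hGo hG)
    (not_finiteDimensional_L2 hd hGo hne hG) (δ := 1 / (|Λ| + 1)) (by positivity)
  rw [embed_apply] at hJq
  -- The inner product of $H^1_0$ contains the $L^2$ term, so $JJ^*$ inverts $1-\Delta$ and
  -- $m=1/(1+\lambda)$. As $Jq=mv$, the gradient of $v$ is that of $q$ divided by $m$.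
  refine ⟨m⁻¹ - 1, v, fun i => ((m⁻¹ : ℝ) : ℂ) • (toProd G q).2 i, ?_, hv1, ?_, ?_⟩
  · rw [lt_div_iff₀ (by positivity)] at hmlt
    have h1 : |Λ| + 1 ≤ m⁻¹ := by
      rw [inv_eq_one_div, le_div_iff₀ hm0]
      linarith
    linarith [le_abs_self Λ]
  · have h1 := toProd_mem (((m⁻¹ : ℝ) : ℂ) • q)
    rw [map_smul] at h1
    convert h1 using 1
    refine Prod.ext ?_ rfl
    rw [Prod.smul_fst, hJq, smul_smul, ← Complex.ofReal_mul, inv_mul_cancel₀ hm0.ne']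
    simp
  · intro p hp
    have h1 := hqp (SobolevSpace.mk p hp)
    rw [embed_apply, inner_eq, toProd_mk, hJq, inner_smul_left, Complex.conj_ofReal] at h1
    have h3 : ∑ i, inner ℂ ((toProd G q).2 i) (p.2 i) = (1 - m) * inner ℂ v p.1 := by
      linear_combination h1
    simp_rw [inner_smul_left, Complex.conj_ofReal]
    rw [← Finset.mul_sum, h3]
    have : (m : ℂ) ≠ 0 := by exact_mod_cast hm0.ne'
    push_cast
    field_simp

end Sobolev

/-! ### From weak solutions to the scalar equation, and the contradiction. -/

lemma HasCaputoDeriv.congr_ae {α T : ℝ} (hT : 0 ≤ T) {g f f' : ℝ → ℂ} (h : HasCaputoDeriv α T g f)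
    (hff' : f =ᵐ[volume.restrict (Ioo 0 T)] f') : HasCaputoDeriv α T g f' := by
  obtain ⟨h1, h2, h3⟩ := h
  rw [restrict_Ioo_eq_restrict_Ioc] at hff'
  refine ⟨h1, h2.congr_ae (by rwa [uIoc_of_le hT]), fun t ht => ?_⟩
  rw [h3 t ht]
  refine intervalIntegral.integral_congr_ae ?_
  rw [EventuallyEq, ae_restrict_iff' measurableSet_Ioc] at hff'
  filter_upwards [hff'] with s hs hst
  rw [uIoc_of_le ht.1] at hst
  exact hs ⟨hst.1, hst.2.trans ht.2⟩

lemma ae_norm_le_norm_of_top {X : Type*} [MeasurableSpace X] {μ : Measure X} (u : Lp ℂ ∞ μ) :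
    ∀ᵐ x ∂μ, ‖u x‖ ≤ ‖u‖ := by
  have h := ae_le_eLpNormEssSup (f := u) (μ := μ)
  rw [← eLpNorm_exponent_top, ← Lp.enorm_def] at h
  filter_upwards [h] with x hx
  simpa [← ofReal_norm] using hx

lemma integral_norm_le_sqrt_mul_norm {d : ℕ} {G : Set (E d)} (hG : Bornology.IsBounded G)
    (v : L2 G) : IntegrableOn (v : E d → ℂ) G ∧
      ∫ x in G, ‖v x‖ ≤ √(volume.real G) * ‖v‖ := by
  have hfin : IsFiniteMeasure ((volume : Measure (E d)).restrict G) :=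
    ⟨by rw [Measure.restrict_apply_univ]; exact hG.measure_lt_top⟩
  have hint : IntegrableOn (v : E d → ℂ) G := (Lp.memLp v).integrable (by norm_num)
  refine ⟨hint, ?_⟩
  have h1 := sq_lintegral_le (volume.restrict G) (f := fun x => ‖v x‖ₑ)
    hint.aestronglyMeasurable.enorm
  rw [← enorm_sq_eq_lintegral, Measure.restrict_apply_univ, ← ofReal_integral_norm_eq_lintegral_enorm
    hint, ← ofReal_norm, ← ENNReal.ofReal_pow (norm_nonneg _),
    ← ENNReal.ofReal_pow (integral_nonneg fun x => norm_nonneg _),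
    ← ENNReal.ofReal_toReal hG.measure_lt_top.ne, ← ENNReal.ofReal_mul ENNReal.toReal_nonneg,
    ENNReal.ofReal_le_ofReal_iff (by positivity)] at h1
  refine abs_le_of_sq_le_sq' ?_ (by positivity) |>.2
  rw [mul_pow, Real.sq_sqrt measureReal_nonneg]
  exact h1

/-- Hölder between $L^\infty$ and $L^1$, then $\|v\|_{L^1}\le|G|^{1/2}\|v\|_{L^2}$: the source term
is bounded uniformly over all unit eigenfunctions. -/
lemma norm_controlPairing_le {d : ℕ} {G G₀ : Set (E d)} (hG : Bornology.IsBounded G)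
    (hG₀G : G₀ ⊆ G) {T : ℝ} (u : Control T G₀) (v : L2 G) :
    ∀ᵐ t ∂(volume.restrict (Ioo 0 T)),
      ‖controlPairing u v t‖ ≤ ‖u‖ * (√(volume.real G) * ‖v‖) := by
  obtain ⟨hint, hle⟩ := integral_norm_le_sqrt_mul_norm hG v
  filter_upwards [Measure.ae_ae_of_ae_prod (ae_norm_le_norm_of_top u)] with t ht
  have h1 : ‖controlPairing u v t‖ ≤ ∫ x in G₀, ‖u‖ * ‖v x‖ := by
    refine norm_integral_le_of_norm_le ((hint.mono_set hG₀G).norm.const_mul _) ?_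
    filter_upwards [ht] with x hx
    rw [norm_mul, RCLike.norm_conj]
    gcongr
  refine h1.trans ?_
  rw [integral_const_mul]
  refine mul_le_mul_of_nonneg_left (le_trans ?_ hle) (norm_nonneg _)
  exact setIntegral_mono_set hint.norm (ae_of_all _ fun x => norm_nonneg _)
    hG₀G.eventuallyLE

/-- Size at time `T` of the component along a Dirichlet eigenfunction of a weak solution that
starts from zero. -/
lemma norm_inner_weakSolution_le {d : ℕ} {G G₀ : Set (E d)} (hG : Bornology.IsBounded G)
    (hG₀G : G₀ ⊆ G) {α T : ℝ} (hα : α ∈ Ioo (0 : ℝ) 1) (hT : 0 < T) {ξ : ℝ} {u : Control T G₀}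
    {y : ℝ → L2 G} (hy : IsWeakSolution α T G G₀ ξ 0 u y) {lam : ℝ} {v : L2 G} {h : Fin d → L2 G}
    (hv : ‖v‖ = 1) (hvh : (v, h) ∈ H10 G)
    (heig : ∀ p ∈ H10 G, ∑ i, inner ℂ (h i) (p.2 i) = lam * inner ℂ v p.1) :
    ‖inner ℂ v (y T)‖ ≤ ‖u‖ * √(volume.real G) * resolventNorm α T (ξ * lam) := by
  obtain ⟨-, hy0, g, hg, hweak⟩ := hy
  have hc := norm_controlPairing_le hG hG₀G u v
  rw [hv, mul_one] at hc
  refine norm_le_of_hasCaputoDeriv (f := fun t => inner ℂ v (y t)) (c := controlPairing u v) hα hT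
    (by simp [hy0]) ?_ (by positivity) hc
  refine (hweak v h hvh).congr_ae hT.le ?_
  filter_upwards [hg] with t ht
  rw [heig _ ht]
  push_cast
  ring

/-- Averaged exact controllability fails: along Dirichlet eigenfunctions with eigenvalue tending to
infinity, the averaged state at time `T` of trajectories starting from zero tends to zero. -/
lemma not_exactlyAveragedControllable {d : ℕ} (hd : 1 ≤ d)
    {Ω : Type*} [MeasurableSpace Ω] (P : Measure Ω) [IsProbabilityMeasure P]
    (ξ : Ω → ℝ) (hξ : Measurable ξ) (hac : HasPDF ξ P volume)
    (α : ℝ) (hα : α ∈ Ioo (0 : ℝ) 1) (T : ℝ) (hT : 0 < T)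
    (G G₀ : Set (E d)) (hG : IsLipschitzDomain G) (hG₀G : G₀ ⊆ G) :
    ¬ ExactlyAveragedControllable P ξ α T G G₀ := by
  rintro ⟨C, hC, hctrl⟩
  -- At $\xi=0$ there would be no dispersion and $\kappa$ would stay $0$; absolute continuity makes
  -- this event null.
  have hξ0 : ∀ᵐ ω ∂P, ξ ω ≠ 0 := by
    have h1 : P.map ξ {0} = 0 := hac.absolutelyContinuous (by simp)
    rw [Measure.map_apply hξ (measurableSet_singleton 0)] at h1
    rw [ae_iff]
    simpa [preimage] using h1
  choose lam v h hlam hv hvh heig using fun n : ℕ =>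
    exists_dirichlet_eigenfunction hd hG.isOpen hG.isConnected.nonempty hG.isBounded (n : ℝ)
  -- Steering from $0$ to the unit vector $v_n$ costs at most $C$, whatever $n$ is.
  choose u hu y hy hyint hyT using fun n : ℕ => hctrl 0 (v n)
  set K : ℝ := C * √(volume.real G) with hK
  have hbound : ∀ᵐ ω ∂P, ∀ n, ‖inner ℂ (v n) (y n ω T)‖ ≤ K * resolventNorm α T (ξ ω * lam n) := by
    rw [ae_all_iff]
    intro n
    filter_upwards [hy n] with ω hω
    refine (norm_inner_weakSolution_le hG.isBounded hG₀G hα hT hω (hv n) (hvh n) (heig n)).trans ?_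
    refine mul_le_mul_of_nonneg_right ?_ (integral_nonneg fun _ => norm_nonneg _)
    have h1 := hu n
    rw [norm_zero, zero_add, hv, mul_one] at h1
    rw [hK]
    gcongr
  obtain ⟨B, hB⟩ := exists_resolventNorm_le hα hT.le
  have hlim : Tendsto (fun n => ∫ ω, inner ℂ (v n) (y n ω T) ∂P) atTop (𝓝 (∫ _, (0 : ℂ) ∂P)) := by
    refine tendsto_integral_of_dominated_convergence (fun _ => K * B)
      (fun n => ((hyint n).const_inner (𝕜 := ℂ) (v n)).aestronglyMeasurable) (integrable_const _)
      (fun n => ?_) ?_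
    · filter_upwards [hbound] with ω hω
      exact (hω n).trans (mul_le_mul_of_nonneg_left (hB _) (by positivity))
    · filter_upwards [hbound, hξ0] with ω hω hω0
      have hκ : Tendsto (fun n => ξ ω * lam n) atTop (comap (fun x => |x|) atTop) := by
        refine tendsto_comap_iff.2 ?_
        have h1 : Tendsto (fun n => |ξ ω| * |lam n|) atTop atTop :=
          Tendsto.const_mul_atTop (abs_pos.2 hω0) (tendsto_abs_atTop_atTop.comp
            (tendsto_atTop_mono hlam tendsto_natCast_atTop_atTop))
        simpa [Function.comp_def, abs_mul] using h1
      have h2 := ((tendsto_resolventNorm hα hT.le).comp hκ).const_mul K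
      rw [mul_zero] at h2
      exact squeeze_zero_norm hω h2
  have hone : ∀ n, ∫ ω, inner ℂ (v n) (y n ω T) ∂P = 1 := by
    intro n
    rw [integral_inner (hyint n), hyT, inner_self_eq_norm_sq_to_K, hv]
    simp
  simp only [hone, integral_zero] at hlim
  exact one_ne_zero (tendsto_nhds_unique tendsto_const_nhds hlim)

end FracSchrodinger

theorem mainTheorem4 {d : ℕ} (hd : 1 ≤ d)
    {Ω : Type*} [MeasurableSpace Ω] (P : Measure Ω) [IsProbabilityMeasure P]
    (ξ : Ω → ℝ) (hξ : Measurable ξ) (hac : HasPDF ξ P volume)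
    (α : ℝ) (hα : α ∈ Ioo (0 : ℝ) 1) (T : ℝ) (hT : 0 < T)
    (G G₀ : Set (FracSchrodinger.E d)) (hG : FracSchrodinger.IsLipschitzDomain G)
    (hG₀G : G₀ ⊆ G) (hG₀m : NullMeasurableSet G₀ volume) (hG₀ : 0 < volume G₀) :
    ¬ FracSchrodinger.ExactlyAveragedControllable P ξ α T G G₀ :=
  FracSchrodinger.not_exactlyAveragedControllable hd P ξ hξ hac α hα T hT G G₀ hG hG₀G
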